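/- Let $c$ be the central charge and let $$\mathcal F(h,\tilde h,c|z)=\sum_{n\ge 0}F_n(h,\tilde h,c)\,z^n,\qquad F_0=1,$$ be the bare four-point Virasoro conformal block with all external dimensions equal to $h$ and intermediate dimension $\tilde h$: $$F_n=\sum_{\lambda,\mu\vdash n}\gamma_\lambda\,(G_n^{-1})_{\lambda\mu}\,\gamma_\mu ,$$ where $G_n$ is the Gram matrix of the contravariant form on level $n$ of the Verma module of highest weight $\tilde h$ and central charge $c$, in the basis $L_{-k_1}\cdots L_{-k_r}|\tilde h\rangle$ with $k_1\ge\dots\ge k_r\ge1$, $\sum_i k_i=n$, and $\gamma_{(k_1,\dots,k_r)}=\prod_i\bigl(\tilde h+(k_i-1)h+\sum_{j>i}k_j\bigr)$. For rational $\alpha>1$ put $h=\delta c^\alpha$, $\tilde h=\tilde\delta c^\alpha$ with real $\delta,\tilde\delta$, $\tilde\delta\ne0$, and expand the coefficients of $z^n$ in $\log\mathcal F$ as formal Puiseux series at $c=\infty$: $$f^{(\alpha)}=\log\mathcal F(\delta c^\alpha,\tilde\delta c^\alpha,c|z)=\sum_{a\in\mathbb Q}f^{(\alpha)}_a\,c^a,\qquad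 f_a^{(\alpha)}=f_a^{(\alpha)}(\delta,\tilde\delta|z).$$ All statements about $f^{(\alpha)}$ and $f^{(\alpha)}_a$ below are modulo $O(z^6)$; equality and inequality of coefficients $f^{(\alpha)}_a$ are those of functions of $(\delta,\tilde\delta)$, $\tilde\delta\neq0$, with values in polynomials in $z$ modulo $z^6$. The principal part $\mathrm{Prin}$ collects the terms with exponents $a\ge0$. The points $(N+1)/N$, $N\ge1$, are called exceptional; all other rational $\alpha>1$ are called regular. Then: 0. The Gram matrices at levels $n\le5$ are invertible for all such $\alpha$, $\delta$, $\tilde\delta$, so that $f^{(\alpha)}$ is well defined modulo $O(z^6)$. 1. Let $N\ge1$ and let $\alpha\in[\frac{N+1}{N},\frac{N}{N-1})$ be rational (the interval is $[2,\infty)$ for $N=1$). Then $$\mathrm{Prin}\,f^{(\alpha)}=\sum_{j=0}^{N}f^{(\alpha)}_{j-(j-1)\alpha}\,c^{\,j-(j-1)\alpha}+f^{(\alpha)}_0,$$ that is, the exponents are $\alpha,\,1,\,2-\alpha,\,3-2\alpha,\dots,\,N-(N-1)\alpha$ and $0$; exactly these $N+2$ coefficients with exponent $a\ge 0$ are non-zero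 functions. In particular there are exactly three terms for every $\alpha\ge2$. 2. If $\alpha\in[\frac{N+1}{N},\frac{N}{N-1})$, $\alpha'\in[\frac{N'+1}{N'},\frac{N'}{N'-1})$ are rational and $0\le j\le\min(N,N')$, then $f^{(\alpha)}_{j-(j-1)\alpha}=f^{(\alpha')}_{j-(j-1)\alpha'}$. 3. $f^{(\alpha)}_0=f^{(\alpha')}_0$ for all regular $\alpha,\alpha'>1$. 4. For every $N\ge1$ the function $f_0^{((N+1)/N)}$ differs from the common function $f_0^{(\alpha)}$ of the regular points, and $f_0^{((N+1)/N)}\ne f_0^{((N'+1)/N')}$ whenever $N\neq N'$. -/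

import Mathlib

/-! ### The Virasoro block with equal external dimensions

Fix a central charge `c` and a highest weight `h`.  A list `[k₁, …, k_r]` of positive integers stands
for the vector `L_{-k₁} ⋯ L_{-k_r} |h⟩` of the Verma module. -/

namespace VirBlock

/-- `applyL c h φ m w` is the value `φ (L_m w)` of a linear functional `φ` (given by its values on the
vectors `L_{-k₁} ⋯ L_{-k_r} |h⟩`), computed from `L_0 |h⟩ = h |h⟩`, `L_m |h⟩ = 0` for `m > 0` and
`L_m L_{-k} = L_{-k} L_m + (m + k) L_{m-k} + δ_{m,k} (c / 12) (m³ - m)`. -/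
def applyL {K : Type*} [Field K] (c h : K) : (List ℕ → K) → ℤ → List ℕ → K
  | φ, m, [] => if m < 0 then φ [m.natAbs] else if m = 0 then h * φ [] else 0
  | φ, m, k :: w =>
      if m < 0 then φ (m.natAbs :: k :: w)
      else applyL c h (fun v => φ (k :: v)) m w + ((m : K) + (k : K)) * applyL c h φ (m - k) w
        + (if m = (k : ℤ) then c / 12 * ((m : K) ^ 3 - (m : K)) * φ w else 0)

/-- The contravariant (Shapovalov) form: `shapovalov c h [k₁, …, k_r] w` is
`⟨h| L_{k_r} ⋯ L_{k₁} w⟩`, normalised by `⟨h|h⟩ = 1`. -/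
def shapovalov {K : Type*} [Field K] (c h : K) : List ℕ → List ℕ → K
  | [], w => if w = [] then 1 else 0
  | k :: u, w => applyL c h (shapovalov c h u) (k : ℤ) w

/-- The vector `L_{-k₁} ⋯ L_{-k_r} v` in a module with operators `L_n`. -/
def descendant {K V : Type*} [Field K] [AddCommGroup V] [Module K V] (L : ℤ → V →ₗ[K] V) (v : V) :
    List ℕ → V
  | [] => v
  | k :: w => L (-(k : ℤ)) (descendant L v w)

/-- The operator product `ψ (L_{k_r} ⋯ L_{k₁} x)`. -/
def braEval {K V : Type*} [Field K] [AddCommGroup V] [Module K V] (L : ℤ → V →ₗ[K] V)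
    (ψ : V →ₗ[K] K) : List ℕ → V →ₗ[K] K
  | [] => ψ
  | k :: u => (braEval L ψ u).comp (L (k : ℤ))

theorem applyL_eq {K V : Type*} [Field K] [AddCommGroup V] [Module K V] (c h : K)
    (L : ℤ → V →ₗ[K] V) (v : V)
    (hL : ∀ m n x, L m (L n x) = L n (L m x) + ((m : K) - (n : K)) • L (m + n) x
      + (if m + n = 0 then c / 12 * ((m : K) ^ 3 - (m : K)) else 0) • x)
    (h0 : L 0 v = h • v) (hpos : ∀ m : ℤ, 0 < m → L m v = 0)
    (w : List ℕ) : (∀ k ∈ w, 0 < k) → ∀ (φ : List ℕ → K) (ψ : V →ₗ[K] K) (m : ℤ),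
      (∀ u, (∀ k ∈ u, 0 < k) → φ u = ψ (descendant L v u)) →
        applyL c h φ m w = ψ (L m (descendant L v w)) := by
  induction w with
  | nil =>
    intro _ φ ψ m hφ
    rw [applyL]
    split_ifs with h1 h2
    · have : -((m.natAbs : ℕ) : ℤ) = m := by omega
      rw [hφ _ (by intro k hk; simp at hk; omega), show descendant L v [m.natAbs] = L m v by simp only [descendant, this]]; rfl
    · subst h2; simp [hφ, descendant, h0]
    · simp [descendant, hpos m (by omega)]
  | cons k w ih =>
    intro hw φ ψ m hφ
    have hk : 0 < k := hw k (by simp)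
    have hw' : ∀ i ∈ w, 0 < i := fun i hi => hw i (by simp [hi])
    have hc : ∀ u, (∀ i ∈ u, 0 < i) → φ (k :: u) = (ψ.comp (L (-(k : ℤ)))) (descendant L v u) := by
      intro u hu
      rw [hφ (k :: u) (by intro i hi; rcases List.mem_cons.1 hi with rfl | hi; exacts [hk, hu i hi])]
      rfl
    rw [applyL]
    split_ifs with h1 h2
    · have : -((m.natAbs : ℕ) : ℤ) = m := by omega
      rw [hφ, descendant, this]
      intro i hi
      rcases List.mem_cons.1 hi with rfl | hi
      · omega
      · exact hw i hi
    · rw [ih hw' _ _ m hc, ih hw' φ ψ (m - k) hφ, hφ w hw', descendant, hL m (-(k : ℤ))]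
      simp [h2]
    · rw [ih hw' _ _ m hc, ih hw' φ ψ (m - k) hφ, descendant, hL m (-(k : ℤ)),
        if_neg (by omega : ¬ m + -(k : ℤ) = 0)]
      simp [sub_eq_add_neg]

/-- `shapovalov` computes the matrix elements `⟨h| L_{k_r} ⋯ L_{k₁} L_{-l₁} ⋯ L_{-l_s} |h⟩` in every
module over the Virasoro algebra with a highest weight vector `v = |h⟩` and a functional `ψ = ⟨h|`. -/
theorem shapovalov_eq {K V : Type*} [Field K] [AddCommGroup V] [Module K V] (c h : K)
    (L : ℤ → V →ₗ[K] V) (v : V)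
    (hL : ∀ m n x, L m (L n x) = L n (L m x) + ((m : K) - (n : K)) • L (m + n) x
      + (if m + n = 0 then c / 12 * ((m : K) ^ 3 - (m : K)) else 0) • x)
    (h0 : L 0 v = h • v) (hpos : ∀ m : ℤ, 0 < m → L m v = 0)
    (ψ : V →ₗ[K] K) (h1 : ψ v = 1) (hψ : ∀ k : ℕ, 0 < k → ∀ x, ψ (L (-(k : ℤ)) x) = 0)
    (u : List ℕ) : ∀ w : List ℕ, (∀ k ∈ w, 0 < k) →
      shapovalov c h u w = braEval L ψ u (descendant L v w) := by
  induction u with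
  | nil =>
    intro w hw
    cases w with
    | nil => simp [shapovalov, braEval, descendant, h1]
    | cons k w => simp [shapovalov, braEval, descendant, hψ k (hw k (by simp))]
  | cons k u ih =>
    intro w hw
    rw [shapovalov, applyL_eq c h L v hL h0 hpos w hw _ (braEval L ψ u) k ih]
    simp [braEval]

/-- The list `k₁ ≥ ⋯ ≥ k_r` of the parts of a partition. -/
def partList {n : ℕ} (p : n.Partition) : List ℕ := p.parts.sort (· ≥ ·)

/-- The level `n` Gram matrix of the Verma module in the basis `L_{-k₁} ⋯ L_{-k_r} |h⟩`,
`k₁ ≥ ⋯ ≥ k_r ≥ 1`, `k₁ + ⋯ + k_r = n`. -/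
def gram {K : Type*} [Field K] (c h : K) (n : ℕ) : Matrix n.Partition n.Partition K :=
  Matrix.of fun p q => shapovalov c h (partList p) (partList q)

/-- The three-point factor `∏ᵢ (ht + kᵢ h₁ - h₂ + ∑_{j > i} kⱼ)` of `L_{-k₁} ⋯ L_{-k_r} |ht⟩` with two
primary fields of equal dimension `h₁ = h₂ = h`. -/
def threePoint {K : Type*} [Field K] (h ht : K) : List ℕ → K
  | [] => 1
  | k :: w => (ht + (k : K) * h - h + (w.sum : K)) * threePoint h ht w

/-- The level `n` coefficient `F_n(h, ht, c)` of the bare four-point Virasoro block with all external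
dimensions equal to `h` and intermediate dimension `ht`. -/
noncomputable def blockCoeff {K : Type*} [Field K] (h ht c : K) (n : ℕ) : K :=
  ∑ p : n.Partition, ∑ q : n.Partition,
    threePoint h ht (partList p) * (gram c ht n)⁻¹ p q * threePoint h ht (partList q)

/-- The bare Virasoro block `∑ F_n(h, ht, c) zⁿ`. -/
noncomputable def block {K : Type*} [Field K] (h ht c : K) : PowerSeries K :=
  PowerSeries.mk (blockCoeff h ht c)

/-! ### Large central charge

Formal series in rational powers of `c`, with exponents bounded above, are Hahn series in `1 / c`:
the coefficient of `c ^ a` is the Hahn coefficient at `-a`. -/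

/-- The monomial `x c ^ a`. -/
noncomputable def cpow (a : ℚ) (x : ℝ) : HahnSeries ℚ ℝ := HahnSeries.single (-a) x

/-- The part of a series with non-negative powers of `c`, the constant term included. -/
def prin (x : HahnSeries ℚ ℝ) : HahnSeries ℚ ℝ where
  coeff i := if i ≤ 0 then x.coeff i else 0
  isPWO_support' := Set.IsPWO.mono x.isPWO_support (by intro i; simp)

/-- The `α`-heavy logarithmic block: `log` of the block at `h = δ c ^ α`, `ht = δt c ^ α`, expanded at
`c = ∞`. -/
noncomputable def logBlock (α : ℚ) (δ δt : ℝ) : PowerSeries (HahnSeries ℚ ℝ) :=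
  PowerSeries.logOf (block (cpow α δ) (cpow α δt) (cpow 1 1))

/-- Classical dimensions `(δ, δt)` with non-zero intermediate dimension. -/
abbrev ClassicalDims : Type := {d : ℝ × ℝ // d.2 ≠ 0}

/-- The coefficient function of `c ^ a` in the `α`-heavy logarithmic block, as a function of the
classical dimensions with values in power series in `z` modulo `z ^ 6`. -/
noncomputable def coeffFun (α a : ℚ) (d : ClassicalDims) : Polynomial ℝ :=
  PowerSeries.trunc 6
    (PowerSeries.mk fun n => (PowerSeries.coeff n (logBlock α d.1.1 d.1.2)).coeff (-a))

/-- The rational numbers in `[(N + 1) / N, N / (N - 1))`, with right end point `∞` if `N = 1`. -/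
def interval (N : ℕ) : Set ℚ := {α | ((N : ℚ) + 1) / N ≤ α ∧ (N = 1 ∨ α < (N : ℚ) / ((N : ℚ) - 1))}

/-- The exceptional point `(N + 1) / N`. -/
def exceptional (N : ℕ) : ℚ := ((N : ℚ) + 1) / N

/-- The exponent `j - (j - 1) α`; it equals `α, 1, 2 - α, 3 - 2 α, …` for `j = 0, 1, 2, 3, …`. -/
def expo (α : ℚ) (j : ℕ) : ℚ := (j : ℚ) - ((j : ℚ) - 1) * α

/-- A rational `α > 1` that is not exceptional. -/
def RegularPoint (α : ℚ) : Prop := 1 < α ∧ ∀ N : ℕ, 1 ≤ N → α ≠ exceptional N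

/-- The exponents `a ≥ 0` of the terms `c ^ a` that occur in the principal part of the `α`-heavy
logarithmic block modulo `z ^ 6`. -/
def prinExponents (α : ℚ) : Set ℚ := {a | 0 ≤ a ∧ coeffFun α a ≠ 0}

end VirBlock

open VirBlock

/-! Put $x=c^{-\alpha}$, $y=c^{1-\alpha}$, $H=\tilde h$ and $w=z^2/(1-z)$, which is invariant under
$z\mapsto z/(z-1)$. Modulo $z^6$ the logarithm of the block is $-\frac H2\log(1-z)+s_2w+s_4w^2$
(`coeff_logOf_block`), where $s_2,s_4$ are explicit rational functions. After homogenisation by a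
variable $e$ equal to $1$, both have degree one: the higher powers of the dimensions cancel in the
logarithm. Multiplying a coefficient $f$ of the logarithm by $x$ therefore replaces $(h,H,c,1)$ by
$(\delta,\tilde\delta,y,x)$. The denominators are products of Kac factors, which at $x=y=0$ reduce
to non-zero multiples of powers of $\tilde\delta$. Hence $xf=G(y)+rx+o(x)$ with $G$ and $r$
independent of $\alpha$ (`exists_expansion`).

Everything is read off from this. The monomial $x^{-1}y^j$ is $c^{\,j-(j-1)\alpha}$ and carries the
coefficient $G_j$; the constant term is $r$; the remainder has negative exponents only. The two
kinds of terms collide exactly when $j-(j-1)\alpha=0$, that is, at $\alpha=(N+1)/N$ with $j=N+1$,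
where the constant term becomes $r+G_{N+1}$.

Non-vanishing is checked on the coefficient of $z^2$. At $\delta=\tilde\delta=1$ one has
$G=\frac3{16}+\frac{25}{64}(1+y/8)^{-1}$: no $G_j$ vanishes, and the shifts at the exceptional
points are non-zero and pairwise different (`expansion_dimsOne`). At $\delta=-\frac14$,
$\tilde\delta=1$ the series $G$ is constant and $r=\frac1{32}$, so the constant term is non-zero for
every $\alpha$ (`expansion_dimsSpecial`).

The Gram matrices are invertible because, with rows rescaled by powers of $x$, they tend to a
triangular matrix with non-zero diagonal (`det_gram_ne_zero`). -/

namespace VirBlock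

/-! ### Enumeration of partitions by non-increasing lists -/

/-- The non-increasing lists of positive integers `≤ m` with sum `n` and at most `f` entries. -/
def descLists : ℕ → ℕ → ℕ → List (List ℕ)
  | 0, _, n => if n = 0 then [[]] else []
  | f + 1, m, n =>
      if n = 0 then [[]]
      else (List.range (min m n)).flatMap fun k =>
        (descLists f (k + 1) (n - (k + 1))).map (List.cons (k + 1))

theorem mem_descLists (f : ℕ) : ∀ (m n : ℕ) (l : List ℕ), l.Pairwise (· ≥ ·) →
    (∀ i ∈ l, 0 < i ∧ i ≤ m) → l.sum = n → l.length ≤ f → l ∈ descLists f m n := by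
  induction f with
  | zero =>
    intro m n l _ _ h3 h4
    obtain rfl : l = [] := List.length_eq_zero_iff.1 (by omega)
    simp_all [descLists]
  | succ f ih =>
    intro m n l h1 h2 h3 h4
    cases l with
    | nil => simp_all [descLists]
    | cons a l =>
      rw [List.sum_cons] at h3
      have ha := h2 a (by simp)
      rw [List.pairwise_cons] at h1
      rw [descLists, if_neg (by omega)]
      simp only [List.mem_flatMap, List.mem_range, List.mem_map]
      refine ⟨a - 1, by omega, l, ?_, by rw [Nat.sub_add_cancel ha.1]⟩
      rw [Nat.sub_add_cancel ha.1]
      exact ih _ _ _ h1.2 (fun i hi => ⟨(h2 i (by simp [hi])).1, h1.1 i hi⟩) (by omega)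
        (by simpa using h4)

theorem partList_pairwise {n : ℕ} (p : n.Partition) : (partList p).Pairwise (· ≥ ·) :=
  Multiset.pairwise_sort _ _

theorem coe_partList {n : ℕ} (p : n.Partition) : (partList p : Multiset ℕ) = p.parts :=
  Multiset.sort_eq _ _

theorem partList_injective {n : ℕ} : Function.Injective (partList (n := n)) := by
  intro p q h
  ext1
  rw [← coe_partList, ← coe_partList, h]

theorem mem_partList {n : ℕ} (p : n.Partition) {i : ℕ} : i ∈ partList p ↔ i ∈ p.parts := by
  rw [← coe_partList, Multiset.mem_coe]

theorem pos_of_mem_partList {n : ℕ} (p : n.Partition) {i : ℕ} (hi : i ∈ partList p) : 0 < i :=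
  p.parts_pos ((mem_partList p).1 hi)

theorem sum_partList {n : ℕ} (p : n.Partition) : (partList p).sum = n := by
  rw [← Multiset.sum_coe, coe_partList, p.parts_sum]

theorem length_le_sum_of_pos (l : List ℕ) (hl : ∀ i ∈ l, 0 < i) : l.length ≤ l.sum := by
  induction l with
  | nil => simp
  | cons a l ih =>
    have := hl a (by simp)
    have := ih fun i hi => hl i (by simp [hi])
    simp only [List.length_cons, List.sum_cons]
    omega

theorem partList_mem_descLists {n : ℕ} (p : n.Partition) : partList p ∈ descLists n n n := by
  refine mem_descLists n n n _ (partList_pairwise p) (fun i hi => ⟨pos_of_mem_partList p hi, ?_⟩)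
    (sum_partList p) ?_
  · exact Nat.Partition.le_of_mem_parts ((mem_partList p).1 hi)
  · exact (length_le_sum_of_pos _ fun i => pos_of_mem_partList p).trans (sum_partList p).le

theorem exists_partList_eq {n : ℕ} (l : List ℕ) (h1 : l.Pairwise (· ≥ ·)) (h2 : ∀ i ∈ l, 0 < i)
    (h3 : l.sum = n) : ∃ p : n.Partition, partList p = l := by
  refine ⟨⟨l, fun {i} hi => h2 i (by simpa using hi), by simpa using h3⟩, ?_⟩
  have h : (partList (⟨l, fun {i} hi => h2 i (by simpa using hi), by simpa using h3⟩ : n.Partition)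
    : Multiset ℕ) = l := coe_partList _
  exact (Multiset.coe_eq_coe.1 h).eq_of_pairwise (fun a b _ _ hab hba => le_antisymm hba hab)
    (partList_pairwise _) h1

/-- A sum over partitions as a sum over an explicit list of lists. -/
theorem sum_partition {K : Type*} [AddCommMonoid K] {n : ℕ} (D : List (List ℕ))
    (hD : descLists n n n = D) (hnd : D.Nodup)
    (hmem : ∀ l ∈ D, l.Pairwise (· ≥ ·) ∧ (∀ i ∈ l, 0 < i) ∧ l.sum = n) (φ : List ℕ → K) :
    ∑ p : n.Partition, φ (partList p) = (D.map φ).sum := by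
  rw [← List.sum_toFinset _ hnd, ← Finset.sum_image (s := Finset.univ) (g := partList) (f := φ)
    (fun p _ q _ h => partList_injective h)]
  congr 1
  ext l
  simp only [Finset.mem_image, Finset.mem_univ, true_and, List.mem_toFinset]
  constructor
  · rintro ⟨p, rfl⟩
    exact hD ▸ partList_mem_descLists p
  · intro hl
    obtain ⟨h1, h2, h3⟩ := hmem l hl
    exact exists_partList_eq l h1 h2 h3

/-- The block coefficient from a solution of `G x = γ`. -/
theorem blockCoeff_eq_of_solution {K : Type*} [Field K] {h ht c : K} {n : ℕ}
    (hdet : (gram c ht n).det ≠ 0) (D : List (List ℕ))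
    (hD : descLists n n n = D) (hnd : D.Nodup)
    (hmem : ∀ l ∈ D, l.Pairwise (· ≥ ·) ∧ (∀ i ∈ l, 0 < i) ∧ l.sum = n) (x : List ℕ → K)
    (hx : ∀ l ∈ D, (D.map fun m => shapovalov c ht l m * x m).sum = threePoint h ht l) :
    blockCoeff h ht c n = (D.map fun m => threePoint h ht m * x m).sum := by
  have hsol : (gram c ht n).mulVec (fun p => x (partList p)) =
      fun p => threePoint h ht (partList p) := by
    funext p
    have := hx (partList p) (hD ▸ partList_mem_descLists p)
    rw [← sum_partition D hD hnd hmem] at this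
    exact this
  -- Invertibility makes the exhibited solution equal to $G^{-1}\gamma$, so the inverse matrix is
  -- never computed.
  have hinv : ((gram c ht n)⁻¹).mulVec (fun p => threePoint h ht (partList p)) =
      fun p => x (partList p) := by
    rw [← hsol, Matrix.mulVec_mulVec, Matrix.nonsing_inv_mul _ (isUnit_iff_ne_zero.2 hdet),
      Matrix.one_mulVec]
  rw [← sum_partition D hD hnd hmem, blockCoeff]
  refine Finset.sum_congr rfl fun p _ => ?_
  rw [← congrFun hinv p, Matrix.mulVec, dotProduct, Finset.mul_sum]
  exact Finset.sum_congr rfl fun q _ => by ring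

/-! ### Coefficients of the logarithm -/

/-- Chain rule: substitute $f-1$ for $X$ in $(1+X)\log'(1+X)=1$. -/
theorem derivative_logOf {A : Type*} [CommRing A] [Algebra ℚ A] {f : PowerSeries A}
    (hf : PowerSeries.constantCoeff f = 1) :
    PowerSeries.derivative A f = f * PowerSeries.derivative A (PowerSeries.logOf f) := by
  have hs : PowerSeries.HasSubst (f - 1) :=
    PowerSeries.HasSubst.of_constantCoeff_zero' (by simp [hf])
  have hg : (1 + PowerSeries.X : PowerSeries A) * PowerSeries.derivative A (PowerSeries.log A) = 1 := by
    rw [PowerSeries.deriv_log]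
    ext n
    cases n with
    | zero => simp
    | succ n =>
      simp [add_mul, PowerSeries.coeff_succ_X_mul, PowerSeries.coeff_one, pow_succ]
  have hg' := congrArg (PowerSeries.subst (f - 1)) hg
  rw [PowerSeries.subst_mul hs, PowerSeries.subst_add hs, PowerSeries.subst_X hs] at hg'
  have h1 : PowerSeries.subst (f - 1) (1 : PowerSeries A) = 1 := by
    rw [← PowerSeries.coe_substAlgHom hs, map_one]
  rw [h1, add_sub_cancel] at hg'
  rw [PowerSeries.logOf_eq, PowerSeries.derivative_subst hs, map_sub, Derivation.map_one_eq_zero, sub_zero,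
    ← mul_assoc, hg', one_mul]

/-- Comparing coefficients in $f'=f\,(\log f)'$ gives a recursion, which avoids expanding the
substituted logarithm. -/
theorem coeff_logOf_succ {A : Type*} [CommRing A] [Algebra ℚ A] {f : PowerSeries A}
    (hf : PowerSeries.constantCoeff f = 1) (n : ℕ) :
    PowerSeries.coeff (n + 1) f * (n + 1) =
      ∑ i ∈ Finset.range (n + 1), PowerSeries.coeff (n - i) f *
        (PowerSeries.coeff (i + 1) (PowerSeries.logOf f) * (i + 1)) := by
  have h := congrArg (PowerSeries.coeff n) (derivative_logOf hf)
  rw [mul_comm, PowerSeries.coeff_derivative, PowerSeries.coeff_mul,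
    Finset.Nat.sum_antidiagonal_eq_sum_range_succ_mk] at h
  rw [h]
  refine Finset.sum_congr rfl fun i _ => ?_
  rw [PowerSeries.coeff_derivative, mul_comm]

/-- The logarithm of a power series with constant term `1`, up to fifth order. -/
theorem coeff_logOf {K : Type*} [Field K] [CharZero K] [Algebra ℚ K] {f : PowerSeries K}
    (hf : PowerSeries.constantCoeff f = 1) {F : ℕ → K} (hF : ∀ n, PowerSeries.coeff n f = F n) :
    PowerSeries.coeff 0 (PowerSeries.logOf f) = 0 ∧
    PowerSeries.coeff 1 (PowerSeries.logOf f) = F 1 ∧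
    PowerSeries.coeff 2 (PowerSeries.logOf f) = F 2 - F 1 ^ 2 / 2 ∧
    PowerSeries.coeff 3 (PowerSeries.logOf f) = F 3 - F 1 * F 2 + F 1 ^ 3 / 3 ∧
    PowerSeries.coeff 4 (PowerSeries.logOf f) =
      F 4 - F 1 * F 3 - F 2 ^ 2 / 2 + F 1 ^ 2 * F 2 - F 1 ^ 4 / 4 ∧
    PowerSeries.coeff 5 (PowerSeries.logOf f) =
      F 5 - F 1 * F 4 - F 2 * F 3 + F 1 ^ 2 * F 3 + F 1 * F 2 ^ 2 - F 1 ^ 3 * F 2 + F 1 ^ 5 / 5 := by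
  have h0 : F 0 = 1 := by rw [← hF 0, PowerSeries.coeff_zero_eq_constantCoeff_apply, hf]
  have h (n : ℕ) := coeff_logOf_succ hf n
  simp only [hF] at h
  have e1 := h 0
  have e2 := h 1
  have e3 := h 2
  have e4 := h 3
  have e5 := h 4
  simp only [Finset.sum_range_succ, Finset.sum_range_zero, h0] at e1 e2 e3 e4 e5
  norm_num [h0] at e1 e2 e3 e4 e5
  generalize PowerSeries.coeff 1 (PowerSeries.logOf f) = f1 at *
  generalize PowerSeries.coeff 2 (PowerSeries.logOf f) = f2 at *
  generalize PowerSeries.coeff 3 (PowerSeries.logOf f) = f3 at *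
  generalize PowerSeries.coeff 4 (PowerSeries.logOf f) = f4 at *
  generalize PowerSeries.coeff 5 (PowerSeries.logOf f) = f5 at *
  have r2 : f2 = F 2 - F 1 ^ 2 / 2 := by rw [e1] at *; linear_combination -e2 / 2
  have r3 : f3 = F 3 - F 1 * F 2 + F 1 ^ 3 / 3 := by
    rw [← e1, r2] at e3; linear_combination -e3 / 3
  have r4 : f4 = F 4 - F 1 * F 3 - F 2 ^ 2 / 2 + F 1 ^ 2 * F 2 - F 1 ^ 4 / 4 := by
    rw [← e1, r2, r3] at e4; linear_combination -e4 / 4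
  refine ⟨by rw [PowerSeries.coeff_zero_eq_constantCoeff_apply, PowerSeries.constantCoeff_logOf hf], e1.symm, r2, r3, r4, ?_⟩
  rw [← e1, r2, r3, r4] at e5
  linear_combination -e5 / 5

/-! ### The block up to level five

The solution of `G x = γ` is organised by quasi-primary vectors: at level two
`L_{-2} - 3 / (2 (2 H + 1)) L_{-1} ^ 2`, at level four a two-dimensional space.  The polynomials below
are homogenised by a variable `e`, which is `1` in the block itself. -/

section Polynomials

variable {R : Type*} [CommRing R]

/-- The factor of the Kac determinant that vanishes at the degenerate weights `h₁₂`, `h₂₁`. -/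
def kacTwoOne (H c e : R) : R := 16 * H ^ 2 - 10 * H * e + 2 * c * H + c * e

/-- The factor of the Kac determinant that vanishes at the degenerate weights `h₁₄`, `h₄₁`. -/
def kacFourOne (H c e : R) : R :=
  16 * H ^ 2 + 10 * H * c - 82 * H * e + 15 * c * e + 66 * e ^ 2

/-- The factor of the Kac determinant that vanishes at the degenerate weight `h₂₂`. -/
def kacTwoTwo (H c e : R) : R := 8 * H + c - e

/-- The numerator of the coefficient of `L_{-2} ^ 2` in the quasi-primary part at level four. -/
def quasiNumTwoTwo (h H c : R) : R :=
    128 * h ^ 2 * H ^ 3 + 80 * h ^ 2 * H ^ 2 * c - 304 * h ^ 2 * H ^ 2 + 160 * h ^ 2 * H * c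
    + 416 * h ^ 2 * H + 60 * h ^ 2 * c - 60 * h ^ 2 + 64 * h * H ^ 4 + 40 * h * H ^ 3 * c
    - 376 * h * H ^ 3 + 36 * h * H ^ 2 * c + 164 * h * H ^ 2 - 28 * h * H * c + 100 * h * H
    + 12 * h * c - 12 * h + 8 * H ^ 5 + 5 * H ^ 4 * c - 51 * H ^ 4 + 2 * H ^ 3 * c + 90 * H ^ 3
    - H ^ 2 * c - 53 * H ^ 2 - 6 * H * c + 6 * H

/-- The numerator of the coefficient of `L_{-1} ^ 4`, up to a factor, in the quasi-primary part at
level four. -/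
def quasiNumOnes (h H c : R) : R :=
    -768 * h ^ 2 * H ^ 3 - 480 * h ^ 2 * H ^ 2 * c - 2784 * h ^ 2 * H ^ 2 - 1920 * h ^ 2 * H * c
    - 1728 * h ^ 2 * H - 1800 * h ^ 2 * c + 1080 * h ^ 2 - 384 * h * H ^ 4 - 240 * h * H ^ 3 * c
    + 2512 * h * H ^ 3 - 56 * h * H ^ 2 * c + 2344 * h * H ^ 2 + 40 * h * H * c ^ 2
    + 392 * h * H * c - 3288 * h * H + 60 * h * c ^ 2 - 96 * h * c + 216 * h - 48 * H ^ 5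
    - 30 * H ^ 4 * c + 338 * H ^ 4 + 8 * H ^ 3 * c - 780 * H ^ 3 + 5 * H ^ 2 * c ^ 2
    - 136 * H ^ 2 * c + 598 * H ^ 2 - 5 * H * c ^ 2 + 158 * H * c - 108 * H

/-- The numerator of the quadratic coefficient of the symmetrised logarithmic block. -/
def logNumTwo (h H c e : R) : R :=
    32 * h ^ 2 * H + 16 * h ^ 2 * e + 16 * h * H ^ 2 - 16 * h * H * e - 6 * H ^ 3 - H ^ 2 * c
    + 4 * H ^ 2 * e

/-- The coefficient of `h ^ k` in `logNumFour`. -/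
def logNumFourCoeff (H c e : R) : ℕ → R
  | 0 =>
      9024 * H ^ 8 + 9384 * H ^ 7 * c - 59016 * H ^ 7 * e + 2856 * H ^ 6 * c ^ 2
      - 21564 * H ^ 6 * c * e + 107880 * H ^ 6 * e ^ 2 + 346 * H ^ 5 * c ^ 3
      - 958 * H ^ 5 * c ^ 2 * e + 21680 * H ^ 5 * c * e ^ 2 - 79808 * H ^ 5 * e ^ 3
      + 15 * H ^ 4 * c ^ 4 + 339 * H ^ 4 * c ^ 3 * e - 190 * H ^ 4 * c ^ 2 * e ^ 2
      - 8392 * H ^ 4 * c * e ^ 3 + 23840 * H ^ 4 * e ^ 4 + 30 * H ^ 3 * c ^ 4 * e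
      - 66 * H ^ 3 * c ^ 3 * e ^ 2 + 240 * H ^ 3 * c ^ 2 * e ^ 3 + 240 * H ^ 3 * c * e ^ 4
      - 1920 * H ^ 3 * e ^ 5 + 10 * H ^ 2 * c ^ 4 * e ^ 2 - 14 * H ^ 2 * c ^ 3 * e ^ 3
      - 188 * H ^ 2 * c ^ 2 * e ^ 4 + 192 * H ^ 2 * c * e ^ 5
  | 1 =>
      -23552 * H ^ 7 - 20864 * H ^ 6 * c + 161152 * H ^ 6 * e - 4288 * H ^ 5 * c ^ 2
      + 39424 * H ^ 5 * c * e - 327168 * H ^ 5 * e ^ 2 - 288 * H ^ 4 * c ^ 3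
      + 320 * H ^ 4 * c ^ 2 * e - 31808 * H ^ 4 * c * e ^ 2 + 272000 * H ^ 4 * e ^ 3
      - 320 * H ^ 3 * c ^ 3 * e + 3776 * H ^ 3 * c ^ 2 * e ^ 2 + 13952 * H ^ 3 * c * e ^ 3
      - 90112 * H ^ 3 * e ^ 4 + 416 * H ^ 2 * c ^ 3 * e ^ 2 - 384 * H ^ 2 * c ^ 2 * e ^ 3
      + 64 * H ^ 2 * c * e ^ 4 + 7680 * H ^ 2 * e ^ 5 + 192 * H * c ^ 3 * e ^ 3
      + 576 * H * c ^ 2 * e ^ 4 - 768 * H * c * e ^ 5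
  | 2 =>
      -43008 * H ^ 6 - 35072 * H ^ 5 * c + 265472 * H ^ 5 * e - 6272 * H ^ 4 * c ^ 2
      + 26496 * H ^ 4 * c * e - 245120 * H ^ 4 * e ^ 2 - 512 * H ^ 3 * c ^ 3
      - 7680 * H ^ 3 * c ^ 2 * e - 8704 * H ^ 3 * c * e ^ 2 - 35584 * H ^ 3 * e ^ 3
      - 1280 * H ^ 2 * c ^ 3 * e - 7744 * H ^ 2 * c ^ 2 * e ^ 2 - 20864 * H ^ 2 * c * e ^ 3
      + 69760 * H ^ 2 * e ^ 4 - 896 * H * c ^ 3 * e ^ 2 - 1728 * H * c ^ 2 * e ^ 3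
      + 2816 * H * c * e ^ 4 - 7680 * H * e ^ 5 - 192 * c ^ 3 * e ^ 3 - 576 * c ^ 2 * e ^ 4
      + 768 * c * e ^ 5
  | 3 =>
      -49152 * H ^ 5 - 22528 * H ^ 4 * c - 43008 * H ^ 4 * e + 2048 * H ^ 3 * c ^ 2
      - 49152 * H ^ 3 * c * e + 15360 * H ^ 3 * e ^ 2 + 5120 * H ^ 2 * c ^ 2 * e
      + 73728 * H ^ 2 * c * e ^ 2 + 62976 * H ^ 2 * e ^ 3 + 3584 * H * c ^ 2 * e ^ 2
      + 10240 * H * c * e ^ 3 - 9216 * H * e ^ 4 + 768 * c ^ 2 * e ^ 3 - 768 * c * e ^ 4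
  | 4 =>
      81920 * H ^ 4 - 22528 * H ^ 3 * c + 325632 * H ^ 3 * e - 56320 * H ^ 2 * c * e
      - 356352 * H ^ 2 * e ^ 2 - 39424 * H * c * e ^ 2 - 25088 * H * e ^ 3 - 8448 * c * e ^ 3
      + 8448 * e ^ 4
  | _ => 0

/-- The numerator of the quartic coefficient of the symmetrised logarithmic block. -/
def logNumFour (h H c e : R) : R :=
  logNumFourCoeff H c e 0 + logNumFourCoeff H c e 1 * h + logNumFourCoeff H c e 2 * h ^ 2
    + logNumFourCoeff H c e 3 * h ^ 3 + logNumFourCoeff H c e 4 * h ^ 4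

end Polynomials

/-! ### Contributions of the quasi-primary vectors -/

section Levels

variable {K : Type*} [Field K]

/-- The coefficient of the quasi-primary vector of level two. -/
def quasiTwo (h H c : K) : K := (H ^ 2 - H + 2 * h * (2 * H + 1)) / kacTwoOne H c 1

/-- The contribution of the quasi-primary vector of level two. -/
def globalTwo (h H c : K) : K :=
  (H ^ 2 - H + 2 * h * (2 * H + 1)) ^ 2 / (2 * (2 * H + 1) * kacTwoOne H c 1)

/-- The coefficient of `L_{-2} ^ 2` in the quasi-primary part at level four. -/
def quasiTwoTwo (h H c : K) : K :=
  quasiNumTwoTwo h H c / (2 * kacTwoOne H c 1 * kacFourOne H c 1 * kacTwoTwo H c 1)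

/-- The coefficient of `-3 L_{-1} ^ 4` in the quasi-primary part at level four. -/
def quasiOnes (h H c : K) : K :=
  quasiNumOnes h H c /
    (16 * (2 * H + 3) * (2 * H + 5) * kacTwoOne H c 1 * kacFourOne H c 1 * kacTwoTwo H c 1)

/-- The coefficient of `L_{-3} L_{-1}` in a quasi-primary vector of level four with given coefficients
`p` of `L_{-2} ^ 2` and `-3 s` of `L_{-1} ^ 4`. -/
def quasiThreeOne (H p s : K) : K := -3 / 2 * p - 2 * (2 * H + 1) * (2 * H + 3) * s

/-- The coefficient of `L_{-4}` in such a vector. -/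
def quasiFour (H p s : K) : K := -(2 * H * quasiThreeOne H p s + 3 * p) / 5

/-- The contribution of the quasi-primary vectors of level four. -/
def globalFour (H h p s : K) : K :=
  (h ^ 2 + 4 / 5 * h * H + h / 5 + H ^ 2 / 10 - H / 10) * p
    + (8 * h * H ^ 3 + 36 * h * H ^ 2 + 36 * h * H + H ^ 4 + 2 * H ^ 3 - 3 * H ^ 2) / 5 * s

/-- The matrix elements of the quasi-primary part at level four. -/
theorem quasi_level_four [CharZero K] {h H c : K} (h1 : 2 * H + 1 ≠ 0) (h3 : 2 * H + 3 ≠ 0)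
    (h5 : 2 * H + 5 ≠ 0) (hA : kacTwoOne H c 1 ≠ 0) (hB : kacFourOne H c 1 ≠ 0)
    (hC : kacTwoTwo H c 1 ≠ 0) :
    (24 / 5 * H ^ 2 + 3 * H * c - 9 / 5 * H) * quasiTwoTwo h H c
      + (128 / 5 * H ^ 4 + 16 * H ^ 3 * c - 304 / 5 * H ^ 3 + 32 * H ^ 2 * c + 416 / 5 * H ^ 2
        + 12 * H * c - 12 * H) * quasiOnes h H c =
      H + 3 * h - 120 * H * ((H + 2) * (H + 3) / (96 * (2 * H + 1) * (2 * H + 3)))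
        - quasiTwo h H c * ((H + 3) / (4 * (2 * H + 5))) *
          (2 * (8 * H + 5 * c) + 2 * (14 * H) + 36 * H - 3 / (2 * (2 * H + 1)) * (120 * H)) ∧
    (232 / 5 * H ^ 2 + 49 / 5 * H * c - 137 / 5 * H + 1 / 2 * c ^ 2 + 11 / 5 * c) *
        quasiTwoTwo h H c
      + (384 / 5 * H ^ 4 + 48 / 5 * H ^ 3 * c + 1488 / 5 * H ^ 3 + 336 / 5 * H ^ 2 * c
        - 552 / 5 * H ^ 2 + 396 / 5 * H * c - 36 * H) * quasiOnes h H c =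
      (H + h + 2) * (H + h) - (216 * H ^ 2 + 144 * H) *
          ((H + 2) * (H + 3) / (96 * (2 * H + 1) * (2 * H + 3)))
        - quasiTwo h H c * ((H + 3) / (4 * (2 * H + 5))) *
          (2 * (24 * H + 3 * c) + 2 * (30 * H) + (48 * H ^ 2 + 6 * H * c + 48 * H)
            - 3 / (2 * (2 * H + 1)) * (216 * H ^ 2 + 144 * H)) := by
  -- The denominators are kept as atoms while fractions are cleared and expanded only for `ring`;
  -- the same device recurs below.
  obtain ⟨A, eA⟩ : ∃ A, A = kacTwoOne H c 1 := ⟨_, rfl⟩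
  obtain ⟨B, eB⟩ : ∃ B, B = kacFourOne H c 1 := ⟨_, rfl⟩
  obtain ⟨C, eC⟩ : ∃ C, C = kacTwoTwo H c 1 := ⟨_, rfl⟩
  obtain ⟨u, eu⟩ : ∃ u, u = 2 * H + 1 := ⟨_, rfl⟩
  obtain ⟨v, ev⟩ : ∃ v, v = 2 * H + 3 := ⟨_, rfl⟩
  obtain ⟨w, ew⟩ : ∃ w, w = 2 * H + 5 := ⟨_, rfl⟩
  simp only [quasiTwoTwo, quasiOnes, quasiTwo, ← eA, ← eB, ← eC, ← eu, ← ev, ← ew] at h1 h3 h5 hA hB hC ⊢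
  constructor
  · field_simp
    simp only [eA, eB, eC, eu, ev, ew, kacTwoOne, kacFourOne, kacTwoTwo, quasiNumTwoTwo,
      quasiNumOnes]
    ring
  · field_simp
    simp only [eA, eB, eC, eu, ev, ew, kacTwoOne, kacFourOne, kacTwoTwo, quasiNumTwoTwo,
      quasiNumOnes]
    ring

end Levels

/-! ### Block coefficients up to level four -/

section Levels

variable {K : Type*} [Field K]

/-- For the quasi-primary vector $Q$ of level two this is $b\,\langle Q,Q\rangle=\gamma(Q)$,
multiplied by $2(2H+1)$. -/
theorem quasiTwo_mul {h H c : K} (hA : kacTwoOne H c 1 ≠ 0) :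
    quasiTwo h H c * (16 * H ^ 2 - 10 * H + 2 * c * H + c) =
      H ^ 2 - H + 2 * h * (2 * H + 1) := by
  have : kacTwoOne H c 1 = 16 * H ^ 2 - 10 * H + 2 * c * H + c := by
    simp [kacTwoOne]
  rw [quasiTwo, ← this, div_mul_cancel₀ _ hA]

theorem globalTwo_eq {h H c : K} (hA : kacTwoOne H c 1 ≠ 0) :
    globalTwo h H c = quasiTwo h H c * (H ^ 2 - H + 2 * h * (2 * H + 1)) / (2 * (2 * H + 1)) := by
  rw [globalTwo, quasiTwo]
  field_simp

theorem blockCoeff_zero (h H c : K) : blockCoeff h H c 0 = 1 := by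
  have hp : partList (default : Nat.Partition 0) = [] := by simp [partList]
  have hg : gram c H 0 = 1 := by
    ext p q
    obtain rfl := Subsingleton.elim p default
    obtain rfl := Subsingleton.elim q default
    simp [gram, hp, shapovalov]
  simp [blockCoeff, hg, hp, threePoint]

theorem blockCoeff_one [CharZero K] {h H c : K} (hdet : (gram c H 1).det ≠ 0) :
    blockCoeff h H c 1 = H / 2 := by
  rw [blockCoeff_eq_of_solution hdet [[1]] (by decide) (by decide) (by decide) (fun _ => 1 / 2)]
  · simp [threePoint]; ring
  · simp [threePoint, shapovalov, applyL]; ring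

/-- The vector dual to the three-point factors at level two. -/
def dualTwo (h H c : K) : List ℕ → K
  | [2] => quasiTwo h H c
  | [1, 1] => (H + 1) / (4 * (2 * H + 1)) - 3 / (2 * (2 * H + 1)) * quasiTwo h H c
  | _ => 0

/-- A quasi-primary vector of weight $\Delta$ enters $G^{-1}\gamma$ together with its descendants
$L_{-1}^m$, weighted by $(\Delta)_m/(m!\,(2\Delta)_m)$. Their contribution to the block carries
$(\Delta)_m^2/(m!\,(2\Delta)_m)$. Here $\Delta=H$, $m=2$ and $\Delta=H+2$, $m=0$; the higher levels
follow the same pattern. -/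
theorem blockCoeff_two [CharZero K] {h H c : K} (hdet : (gram c H 2).det ≠ 0)
    (h1 : 2 * H + 1 ≠ 0) (hA : kacTwoOne H c 1 ≠ 0) :
    blockCoeff h H c 2 = H * (H + 1) ^ 2 / (4 * (2 * H + 1)) + globalTwo h H c := by
  have hb := quasiTwo_mul (h := h) hA
  rw [blockCoeff_eq_of_solution hdet [[1, 1], [2]] (by decide) (by decide) (by decide)
    (dualTwo h H c), globalTwo_eq hA]
  · simp only [List.map_cons, List.map_nil, List.sum_cons, List.sum_nil, threePoint, dualTwo]
    obtain ⟨u, eu⟩ : ∃ u, u = 2 * H + 1 := ⟨_, rfl⟩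
    simp only [← eu] at h1 ⊢
    push_cast
    field_simp
    simp only [eu]
    ring
  · obtain ⟨u, eu⟩ : ∃ u, u = 2 * H + 1 := ⟨_, rfl⟩
    simp only [dualTwo, ← eu, List.map_cons, List.map_nil, List.sum_cons, List.sum_nil,
      List.forall_mem_cons] at h1 hb ⊢
    refine ⟨?_, ?_⟩ <;> simp [shapovalov, applyL, threePoint]
    · field_simp; simp only [eu]; ring
    · linear_combination (norm := (field_simp; simp only [eu]; ring)) 1 / (2 * u) * hb

/-- The vector dual to the three-point factors at level three. -/
def dualThree (h H c : K) : List ℕ → K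
  | [3] => quasiTwo h H c / 2
  | [2, 1] => quasiTwo h H c / 2
  | [1, 1, 1] => (H + 2) / (24 * (2 * H + 1)) - 3 / (4 * (2 * H + 1)) * quasiTwo h H c
  | _ => 0

theorem blockCoeff_three [CharZero K] {h H c : K} (hdet : (gram c H 3).det ≠ 0)
    (h1 : 2 * H + 1 ≠ 0) (hA : kacTwoOne H c 1 ≠ 0) :
    blockCoeff h H c 3 = H * (H + 1) * (H + 2) ^ 2 / (24 * (2 * H + 1))
      + globalTwo h H c * ((H + 2) / 2) := by
  have hb := quasiTwo_mul (h := h) hA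
  rw [blockCoeff_eq_of_solution hdet [[1, 1, 1], [2, 1], [3]] (by decide) (by decide) (by decide)
    (dualThree h H c), globalTwo_eq hA]
  · simp only [List.map_cons, List.map_nil, List.sum_cons, List.sum_nil, threePoint, dualThree]
    obtain ⟨u, eu⟩ : ∃ u, u = 2 * H + 1 := ⟨_, rfl⟩
    simp only [← eu] at h1 ⊢
    push_cast
    field_simp
    simp only [eu]
    ring
  · obtain ⟨u, eu⟩ : ∃ u, u = 2 * H + 1 := ⟨_, rfl⟩
    simp only [dualThree, ← eu, List.map_cons, List.map_nil, List.sum_cons, List.sum_nil,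
      List.forall_mem_cons] at h1 hb ⊢
    refine ⟨?_, ?_, ?_⟩ <;> simp [shapovalov, applyL, threePoint]
    · field_simp; simp only [eu]; ring
    · linear_combination (norm := (field_simp; simp only [eu]; ring)) H / (2 * u) * hb
    · linear_combination (norm := (field_simp; simp only [eu]; ring)) 1 / u * hb

/-- The vector dual to the three-point factors at level four, in terms of the coefficients `b`, `p`,
`s` of the quasi-primary vectors. -/
def dualFour (H b p s : K) : List ℕ → K
  | [4] => 2 * b * ((H + 3) / (4 * (2 * H + 5))) + quasiFour H p s
  | [3, 1] => 2 * b * ((H + 3) / (4 * (2 * H + 5))) + quasiThreeOne H p s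
  | [2, 2] => p
  | [2, 1, 1] => b * ((H + 3) / (4 * (2 * H + 5))) + 4 * (2 * H + 3) * s
  | [1, 1, 1, 1] => (H + 2) * (H + 3) / (96 * (2 * H + 1) * (2 * H + 3))
      - 3 / (2 * (2 * H + 1)) * b * ((H + 3) / (4 * (2 * H + 5))) - 3 * s
  | _ => 0

/-- The level-four ansatz is annihilated by $L_1$, hence orthogonal to all $L_{-1}$-descendants. Its
two free coefficients $p,s$ are fixed by pairing with $L_{-4}$ and $L_{-2}^2$, which is
`quasi_level_four`. -/
theorem blockCoeff_four [CharZero K] {h H c : K} (hdet : (gram c H 4).det ≠ 0)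
    (h1 : 2 * H + 1 ≠ 0) (h3 : 2 * H + 3 ≠ 0) (h5 : 2 * H + 5 ≠ 0) (hA : kacTwoOne H c 1 ≠ 0)
    (hB : kacFourOne H c 1 ≠ 0) (hC : kacTwoTwo H c 1 ≠ 0) :
    blockCoeff h H c 4 =
      H * (H + 1) * (H + 2) ^ 2 * (H + 3) ^ 2 / (96 * (2 * H + 1) * (2 * H + 3))
      + globalTwo h H c * ((H + 2) * (H + 3) ^ 2 / (4 * (2 * H + 5)))
      + globalFour H h (quasiTwoTwo h H c) (quasiOnes h H c) := by
  have hb := quasiTwo_mul (h := h) hA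
  obtain ⟨hw, hw'⟩ := quasi_level_four (h := h) h1 h3 h5 hA hB hC
  rw [blockCoeff_eq_of_solution hdet [[1, 1, 1, 1], [2, 1, 1], [2, 2], [3, 1], [4]] (by decide)
    (by decide) (by decide)
    (dualFour H (quasiTwo h H c) (quasiTwoTwo h H c) (quasiOnes h H c)), globalTwo_eq hA]
  all_goals
    generalize quasiTwo h H c = b at *
    generalize quasiTwoTwo h H c = p at *
    generalize quasiOnes h H c = s at *
    clear hA hB hC hdet
    obtain ⟨u, eu⟩ : ∃ u, u = 2 * H + 1 := ⟨_, rfl⟩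
    obtain ⟨v, ev⟩ : ∃ v, v = 2 * H + 3 := ⟨_, rfl⟩
    obtain ⟨w, ew⟩ : ∃ w, w = 2 * H + 5 := ⟨_, rfl⟩
  · simp only [List.map_cons, List.map_nil, List.sum_cons, List.sum_nil, threePoint, dualFour,
      globalFour, quasiFour, quasiThreeOne]
    simp only [← eu, ← ev, ← ew] at h1 h3 h5 ⊢
    push_cast
    field_simp
    simp only [eu, ev, ew]
    ring
  · simp only [dualFour, quasiFour, quasiThreeOne, ← eu, ← ev, ← ew, List.map_cons, List.map_nil,
      List.sum_cons, List.sum_nil, List.forall_mem_cons]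
      at h1 h3 h5 hb hw hw' ⊢
    refine ⟨?_, ?_, ?_, ?_, ?_⟩ <;> simp [shapovalov, applyL, threePoint]
    · field_simp; simp only [eu, ev, ew]; ring
    -- Modulo $L_{-1}$-descendants, $L_{-2}L_{-1}^2\equiv2L_{-4}$ and $L_{-3}L_{-1}\equiv-2L_{-4}$;
    -- hence the multiples $2$ and $-2$ of `hw`.
    · linear_combination (norm := (field_simp; simp only [eu, ev, ew]; ring))
        2 * hw + (H ^ 2 + H - 6) / (2 * u) * hb
    · linear_combination (norm := (field_simp; simp only [eu, ev, ew]; ring)) hw'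
    · linear_combination (norm := (field_simp; simp only [eu, ev, ew]; ring))
        -2 * hw + (H + 3) / u * hb
    · linear_combination (norm := (field_simp; simp only [eu, ev, ew]; ring)) hw

end Levels

/-! ### Level five, and the logarithm at level four -/

section Levels

variable {K : Type*} [Field K]

/-- The vector dual to the three-point factors at level five, in terms of the coefficients `b`, `p`,
`s` of the quasi-primary vectors. -/
def dualFive (H b p s : K) : List ℕ → K
  | [5] => 6 * b * ((H + 4) / (24 * (2 * H + 5))) + (3 * quasiFour H p s + p) / 2
  | [4, 1] => 6 * b * ((H + 4) / (24 * (2 * H + 5)))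
      + (quasiFour H p s + 2 * quasiThreeOne H p s) / 2
  | [3, 2] => p
  | [3, 1, 1] => 3 * b * ((H + 4) / (24 * (2 * H + 5)))
      + (quasiThreeOne H p s + 4 * (2 * H + 3) * s) / 2
  | [2, 2, 1] => p / 2
  | [2, 1, 1, 1] => b * ((H + 4) / (24 * (2 * H + 5))) + 4 * (2 * H + 3) * s / 2
  | [1, 1, 1, 1, 1] => (H + 3) * (H + 4) / (960 * (2 * H + 1) * (2 * H + 3))
      - 3 / (2 * (2 * H + 1)) * b * ((H + 4) / (24 * (2 * H + 5))) - 3 * s / 2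
  | _ => 0

set_option maxHeartbeats 4000000 in
theorem blockCoeff_five [CharZero K] {h H c : K} (hdet : (gram c H 5).det ≠ 0)
    (h1 : 2 * H + 1 ≠ 0) (h3 : 2 * H + 3 ≠ 0) (h5 : 2 * H + 5 ≠ 0) (hA : kacTwoOne H c 1 ≠ 0)
    (hB : kacFourOne H c 1 ≠ 0) (hC : kacTwoTwo H c 1 ≠ 0) :
    blockCoeff h H c 5 =
      H * (H + 1) * (H + 2) * (H + 3) ^ 2 * (H + 4) ^ 2 / (960 * (2 * H + 1) * (2 * H + 3))
      + globalTwo h H c * ((H + 2) * (H + 3) * (H + 4) ^ 2 / (24 * (2 * H + 5)))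
      + globalFour H h (quasiTwoTwo h H c) (quasiOnes h H c) * ((H + 4) / 2) := by
  have hb := quasiTwo_mul (h := h) hA
  obtain ⟨hw, hw'⟩ := quasi_level_four (h := h) h1 h3 h5 hA hB hC
  rw [blockCoeff_eq_of_solution hdet [[1, 1, 1, 1, 1], [2, 1, 1, 1], [2, 2, 1], [3, 1, 1], [3, 2],
    [4, 1], [5]] (by decide) (by decide) (by decide)
    (dualFive H (quasiTwo h H c) (quasiTwoTwo h H c) (quasiOnes h H c)), globalTwo_eq hA]
  all_goals
    generalize quasiTwo h H c = b at *
    generalize quasiTwoTwo h H c = p at *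
    generalize quasiOnes h H c = s at *
    clear hA hB hC hdet
    obtain ⟨u, eu⟩ : ∃ u, u = 2 * H + 1 := ⟨_, rfl⟩
    obtain ⟨v, ev⟩ : ∃ v, v = 2 * H + 3 := ⟨_, rfl⟩
    obtain ⟨w, ew⟩ : ∃ w, w = 2 * H + 5 := ⟨_, rfl⟩
  · simp only [List.map_cons, List.map_nil, List.sum_cons, List.sum_nil, threePoint, dualFive,
      globalFour, quasiFour, quasiThreeOne]
    simp only [← eu, ← ev, ← ew] at h1 h3 h5 ⊢
    push_cast
    field_simp
    simp only [eu, ev, ew]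
    ring
  · simp only [dualFive, quasiFour, quasiThreeOne, ← eu, ← ev, ← ew, List.map_cons, List.map_nil,
      List.sum_cons, List.sum_nil, List.forall_mem_cons] at h1 h3 h5 hb hw hw' ⊢
    refine ⟨?_, ?_, ?_, ?_, ?_, ?_, ?_⟩ <;> simp [shapovalov, applyL, threePoint]
    · field_simp; simp only [eu, ev, ew]; ring
    -- The level-four quasi-primary part enters as $\frac12L_{-1}Q$, and $\langle
    -- u,L_{-1}Q\rangle=\langle L_1u,Q\rangle$. The multiples of `hw` and `hw'` are thus the
    -- coefficients of $L_{-4}$ and $L_{-2}^2$ in $\frac12L_1u$ modulo $L_{-1}$-descendants.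
    · linear_combination (norm := (field_simp; simp only [eu, ev, ew]; ring))
        (6 * H + 6) * hw + (H ^ 3 + 3 * H ^ 2 - 16 * H - 18) / (2 * u) * hb
    · linear_combination (norm := (field_simp; simp only [eu, ev, ew]; ring))
        3 * hw + H * hw' + (2 * H - 9) / (2 * u) * hb
    · linear_combination (norm := (field_simp; simp only [eu, ev, ew]; ring))
        (2 - 4 * H) * hw + (H ^ 2 + 7 * H - 3) / u * hb
    · linear_combination (norm := (field_simp; simp only [eu, ev, ew]; ring))
        2 * hw' - 3 * hw + (7 - H) / (2 * u) * hb
    · linear_combination (norm := (field_simp; simp only [eu, ev, ew]; ring))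
        (H - 5) * hw + 15 / (2 * u) * hb
    · linear_combination (norm := (field_simp; simp only [eu, ev, ew]; ring))
        3 * hw - 5 / (2 * u) * hb

set_option maxHeartbeats 4000000 in
set_option maxRecDepth 4000 in
/-- The quartic coefficient of the symmetrised logarithmic block has a simple pole only. -/
theorem log_level_four [CharZero K] {h H c : K}
    (h1 : 2 * H + 1 ≠ 0) (h3 : 2 * H + 3 ≠ 0) (h5 : 2 * H + 5 ≠ 0) (hA : kacTwoOne H c 1 ≠ 0)
    (hB : kacFourOne H c 1 ≠ 0) (hC : kacTwoTwo H c 1 ≠ 0) :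
    globalFour H h (quasiTwoTwo h H c) (quasiOnes h H c) =
      logNumFour h H c 1 / (64 * kacTwoOne H c 1 ^ 2 * kacFourOne H c 1 * kacTwoTwo H c 1)
      + globalTwo h H c ^ 2 / 2
      + globalTwo h H c * ((H ^ 2 + 3 * H + 1) / (2 * (2 * H + 1) * (2 * H + 5)))
      - H ^ 2 * (3 * H ^ 2 + 6 * H + 2) / (64 * (2 * H + 1) ^ 2 * (2 * H + 3)) := by
  obtain ⟨A, eA⟩ : ∃ A, A = kacTwoOne H c 1 := ⟨_, rfl⟩
  obtain ⟨B, eB⟩ : ∃ B, B = kacFourOne H c 1 := ⟨_, rfl⟩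
  obtain ⟨C, eC⟩ : ∃ C, C = kacTwoTwo H c 1 := ⟨_, rfl⟩
  obtain ⟨u, eu⟩ : ∃ u, u = 2 * H + 1 := ⟨_, rfl⟩
  obtain ⟨v, ev⟩ : ∃ v, v = 2 * H + 3 := ⟨_, rfl⟩
  obtain ⟨w, ew⟩ : ∃ w, w = 2 * H + 5 := ⟨_, rfl⟩
  simp only [globalFour, globalTwo, quasiTwoTwo, quasiOnes, ← eA, ← eB, ← eC, ← eu, ← ev, ← ew]
    at h1 h3 h5 hA hB hC ⊢
  field_simp
  simp only [eA, eB, eC, eu, ev, ew, kacTwoOne, kacFourOne, kacTwoTwo, quasiNumTwoTwo,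
    quasiNumOnes, logNumFour, logNumFourCoeff]
  ring

end Levels

/-- The logarithmic block up to level five. -/
theorem coeff_logOf_block {K : Type*} [Field K] [CharZero K] [Algebra ℚ K] {h H c : K}
    (hdet : ∀ n < 6, (gram c H n).det ≠ 0)
    (h1 : 2 * H + 1 ≠ 0) (h3 : 2 * H + 3 ≠ 0) (h5 : 2 * H + 5 ≠ 0) (hA : kacTwoOne H c 1 ≠ 0)
    (hB : kacFourOne H c 1 ≠ 0) (hC : kacTwoTwo H c 1 ≠ 0) {s₂ s₄ : K}
    (hs₂ : s₂ = logNumTwo h H c 1 / (8 * kacTwoOne H c 1))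
    (hs₄ : s₄ = logNumFour h H c 1 /
      (64 * kacTwoOne H c 1 ^ 2 * kacFourOne H c 1 * kacTwoTwo H c 1)) :
    PowerSeries.coeff 0 (PowerSeries.logOf (block h H c)) = 0 ∧
    PowerSeries.coeff 1 (PowerSeries.logOf (block h H c)) = H / 2 ∧
    PowerSeries.coeff 2 (PowerSeries.logOf (block h H c)) = H / 4 + s₂ ∧
    PowerSeries.coeff 3 (PowerSeries.logOf (block h H c)) = H / 6 + s₂ ∧
    PowerSeries.coeff 4 (PowerSeries.logOf (block h H c)) = H / 8 + s₂ + s₄ ∧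
    PowerSeries.coeff 5 (PowerSeries.logOf (block h H c)) = H / 10 + s₂ + 2 * s₄ := by
  have hcc : PowerSeries.constantCoeff (block h H c) = 1 := by
    rw [← PowerSeries.coeff_zero_eq_constantCoeff_apply, block, PowerSeries.coeff_mk,
      blockCoeff_zero]
  have hF (n : ℕ) : PowerSeries.coeff n (block h H c) = blockCoeff h H c n := by
    rw [block, PowerSeries.coeff_mk]
  -- The second coefficient of the logarithm, $F_2-H^2/8$, has to be $H/4+s_2$; this is that
  -- relation solved for `globalTwo`.
  have hg : globalTwo h H c =
      s₂ + H / 4 + H ^ 2 / 8 - H * (H + 1) ^ 2 / (4 * (2 * H + 1)) := by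
    rw [hs₂, globalTwo]
    obtain ⟨u, eu⟩ : ∃ u, u = 2 * H + 1 := ⟨_, rfl⟩
    obtain ⟨A, eA⟩ : ∃ A, A = kacTwoOne H c 1 := ⟨_, rfl⟩
    simp only [← eu, ← eA] at h1 hA ⊢
    field_simp
    simp only [eu, eA, kacTwoOne, logNumTwo]
    ring
  obtain ⟨e0, e1, e2, e3, e4, e5⟩ := coeff_logOf hcc hF
  rw [e0, e1, e2, e3, e4, e5, blockCoeff_one (hdet 1 (by norm_num)),
    blockCoeff_two (hdet 2 (by norm_num)) h1 hA, blockCoeff_three (hdet 3 (by norm_num)) h1 hA,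
    blockCoeff_four (hdet 4 (by norm_num)) h1 h3 h5 hA hB hC,
    blockCoeff_five (hdet 5 (by norm_num)) h1 h3 h5 hA hB hC,
    log_level_four h1 h3 h5 hA hB hC, ← hs₄, hg]
  clear hs₂ hs₄ hA hB hC hg hF hcc e0 e1 e2 e3 e4 e5 hdet
  obtain ⟨u, eu⟩ : ∃ u, u = 2 * H + 1 := ⟨_, rfl⟩
  obtain ⟨v, ev⟩ : ∃ v, v = 2 * H + 3 := ⟨_, rfl⟩
  obtain ⟨w, ew⟩ : ∃ w, w = 2 * H + 5 := ⟨_, rfl⟩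
  simp only [← eu, ← ev, ← ew] at h1 h3 h5 ⊢
  refine ⟨trivial, trivial, ?_, ?_, ?_, ?_⟩
  all_goals
    field_simp
    simp only [eu, ev, ew]
    ring

/-! ### Leading behaviour of the Gram matrix for large highest weight -/

/-- The coefficient of the highest power of the highest weight in `applyL`. -/
def leadL : (List ℕ → ℝ) → ℤ → List ℕ → ℝ
  | φ, m, [] => if m = 0 then φ [] else 0
  | φ, m, k :: w =>
      if m < 0 then 0
      else leadL (fun v => φ (k :: v)) m w + ((m : ℝ) + (k : ℝ)) * leadL φ (m - k) w

/-- The coefficient of the highest power of the highest weight in `shapovalov`. -/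
def leadForm : List ℕ → List ℕ → ℝ
  | [], w => if w = [] then 1 else 0
  | k :: u, w => leadL (leadForm u) (k : ℤ) w

theorem leadL_of_neg (φ : List ℕ → ℝ) {m : ℤ} (hm : m < 0) (w : List ℕ) : leadL φ m w = 0 := by
  cases w with
  | nil => rw [leadL, if_neg (by omega)]
  | cons k w => rw [leadL, if_pos hm]

/-- $L_0$ acts on a word by the highest weight plus its level, so the highest weight has coefficient
one. -/
theorem leadL_zero (w : List ℕ) : ∀ φ : List ℕ → ℝ, leadL φ 0 w = φ w := by
  induction w with
  | nil => intro φ; simp [leadL]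
  | cons k w ih =>
    intro φ
    rw [leadL, if_neg (by omega), ih]
    rcases Nat.eq_zero_or_pos k with rfl | hk
    · simp
    · rw [leadL_of_neg φ (by omega), mul_zero, add_zero]

theorem leadL_nonneg (w : List ℕ) : ∀ (φ : List ℕ → ℝ) (m : ℤ), (∀ v, 0 ≤ φ v) →
    0 ≤ leadL φ m w := by
  induction w with
  | nil => intro φ m hφ; rw [leadL]; split_ifs; exacts [hφ _, le_rfl]
  | cons k w ih =>
    intro φ m hφ
    rw [leadL]
    split_ifs with hm
    · exact le_rfl
    · have : (0 : ℝ) ≤ m := by exact_mod_cast not_lt.1 hm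
      exact add_nonneg (ih _ _ fun v => hφ _) (mul_nonneg (by positivity) (ih _ _ hφ))

/-- For $m>0$, $L_m$ produces a factor of the highest weight only after absorbing at least one
$L_{-k}$, which leaves a word shorter than $r$. -/
theorem leadL_eq_zero_of_length_le (w : List ℕ) : ∀ (φ : List ℕ → ℝ) (m : ℤ) (r : ℕ), 0 < m →
    (∀ v, v.length < r → φ v = 0) → w.length ≤ r → leadL φ m w = 0 := by
  induction w with
  | nil => intro φ m r hm _ _; rw [leadL, if_neg (by omega)]
  | cons k w ih =>
    intro φ m r hm hφ hw
    rw [List.length_cons] at hw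
    rw [leadL, if_neg (by omega), ih _ m (r - 1) hm
      (fun v hv => hφ _ (by rw [List.length_cons]; omega)) (by omega), zero_add]
    rcases lt_trichotomy (m - k) 0 with h | h | h
    · rw [leadL_of_neg _ h, mul_zero]
    · rw [h, leadL_zero, hφ _ (by omega), mul_zero]
    · rw [ih φ _ r h hφ (by omega), mul_zero]

/-- With $r+1$ letters exactly one may be absorbed, and a single commutator gives $L_0$ only if that
letter is $L_{-m}$. -/
theorem exists_perm_of_leadL_ne_zero (w : List ℕ) : ∀ (φ : List ℕ → ℝ) (m r : ℕ), 0 < m →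
    (∀ v, v.length < r → φ v = 0) → w.length = r + 1 → leadL φ m w ≠ 0 →
    ∃ v, φ v ≠ 0 ∧ w.Perm (m :: v) := by
  induction w with
  | nil => intro φ m r _ _ h; simp at h
  | cons k w ih =>
    intro φ m r hm hφ hw h
    rw [List.length_cons] at hw
    rw [leadL, if_neg (by omega)] at h
    by_cases h' : leadL (fun v => φ (k :: v)) m w = 0
    · rw [h', zero_add] at h
      rcases lt_trichotomy ((m : ℤ) - k) 0 with hk | hk | hk
      · rw [leadL_of_neg _ hk, mul_zero] at h; exact absurd rfl h
      · rw [hk, leadL_zero] at h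
        obtain rfl : m = k := by omega
        exact ⟨w, right_ne_zero_of_mul h, List.Perm.refl _⟩
      · rw [leadL_eq_zero_of_length_le w φ _ r hk hφ (by omega), mul_zero] at h
        exact absurd rfl h
    · cases r with
      | zero =>
        obtain rfl : w = [] := List.length_eq_zero_iff.1 (by omega)
        rw [leadL, if_neg (by omega)] at h'
        exact absurd rfl h'
      | succ r =>
        obtain ⟨v, hv, hp⟩ := ih (fun v => φ (k :: v)) m r hm
          (fun v hv => hφ _ (by rw [List.length_cons]; omega)) (by omega) h'
        exact ⟨k :: v, hv, (hp.cons k).trans (List.Perm.swap _ _ _)⟩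

theorem leadForm_nonneg (u : List ℕ) : ∀ w, 0 ≤ leadForm u w := by
  induction u with
  | nil => intro w; rw [leadForm]; split_ifs <;> norm_num
  | cons k u ih => exact fun w => leadL_nonneg w _ _ ih

theorem leadForm_eq_zero_of_length_lt (u : List ℕ) : (∀ i ∈ u, 0 < i) →
    ∀ w : List ℕ, w.length < u.length → leadForm u w = 0 := by
  induction u with
  | nil => intro _ w hw; simp at hw
  | cons k u ih =>
    intro hu w hw
    have hk := hu k (by simp)
    exact leadL_eq_zero_of_length_le w _ _ u.length (by omega)
      (ih fun i hi => hu i (by simp [hi])) (by rw [List.length_cons] at hw; omega)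

theorem perm_of_leadForm_ne_zero (u : List ℕ) : (∀ i ∈ u, 0 < i) →
    ∀ w : List ℕ, w.length = u.length → leadForm u w ≠ 0 → w.Perm u := by
  induction u with
  | nil => intro _ w hw _; rw [List.length_eq_zero_iff.1 hw]
  | cons k u ih =>
    intro hu w hw h
    have hu' : ∀ i ∈ u, 0 < i := fun i hi => hu i (by simp [hi])
    obtain ⟨v, hv, hp⟩ := exists_perm_of_leadL_ne_zero w (leadForm u) k u.length (hu k (by simp))
      (leadForm_eq_zero_of_length_lt u hu') (by simpa using hw) h
    refine hp.trans ((ih hu' v ?_ hv).cons k)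
    have := hp.length_eq
    simp only [List.length_cons] at this hw
    omega

/-- No contribution is negative, and contracting the outermost pair gives $2k$ times the form of the
remaining words. -/
theorem leadForm_self_pos (u : List ℕ) (hu : ∀ i ∈ u, 0 < i) : 0 < leadForm u u := by
  induction u with
  | nil => simp [leadForm]
  | cons k u ih =>
    have hk : (0 : ℝ) < k := by exact_mod_cast hu k (by simp)
    rw [leadForm, leadL, if_neg (by omega), sub_self, leadL_zero]
    refine add_pos_of_nonneg_of_pos (leadL_nonneg _ _ _ fun v => leadForm_nonneg _ _)
      (mul_pos (by push_cast; positivity) (ih fun i hi => hu i (by simp [hi])))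

/-- Ordered by length the matrix is triangular: entries with a shorter right word vanish, and words
of equal length pair non-trivially only if they are permutations of each other. The list component
of `key` merely breaks ties. -/
theorem det_leadForm_ne_zero (n : ℕ) :
    (Matrix.of fun p q : n.Partition => leadForm (partList p) (partList q)).det ≠ 0 := by
  let key : n.Partition → ℕ ×ₗ List ℕ := fun p => toLex ((partList p).length, partList p)
  have hkey : Function.Injective key := fun p q h => partList_injective (Prod.ext_iff.1 h).2
  let : LinearOrder n.Partition := LinearOrder.lift' key hkey
  have htri : (Matrix.of fun p q : n.Partition =>
      leadForm (partList p) (partList q)).BlockTriangular id := by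
    intro p q hqp
    have hlt : key q < key p := hqp
    by_contra hne
    rw [Matrix.of_apply] at hne
    have hpos (p : n.Partition) : ∀ i ∈ partList p, 0 < i := fun i => pos_of_mem_partList p
    rcases (Prod.Lex.lt_iff).1 hlt with h | ⟨h, h'⟩
    · exact hne (leadForm_eq_zero_of_length_lt _ (hpos p) _ h)
    · have hp := perm_of_leadForm_ne_zero _ (hpos p) _ h hne
      have : partList q = partList p := hp.eq_of_pairwise
        (fun a b _ _ hab hba => le_antisymm hba hab) (partList_pairwise q) (partList_pairwise p)
      rw [partList_injective this] at hlt
      exact lt_irrefl _ hlt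
  rw [Matrix.det_of_isUpperTriangular htri]
  exact Finset.prod_ne_zero_iff.2 fun p _ =>
    (leadForm_self_pos _ fun i => pos_of_mem_partList p).ne'

/-! ### Residues of Hahn series -/

instance : CharZero (HahnSeries ℚ ℝ) :=
  charZero_of_injective_ringHom (HahnSeries.C_injective (Γ := ℚ) (R := ℝ))

theorem lt_orderTop_add {g : WithTop ℚ} {u v : HahnSeries ℚ ℝ} (hu : g < u.orderTop)
    (hv : g < v.orderTop) : g < (u + v).orderTop :=
  (lt_min hu hv).trans_le HahnSeries.min_orderTop_le_orderTop_add

theorem lt_orderTop_mul {g : WithTop ℚ} {u v : HahnSeries ℚ ℝ} (hu : 0 ≤ u.orderTop)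
    (hv : g < v.orderTop) : g < (u * v).orderTop := by
  rw [HahnSeries.orderTop_mul]
  exact hv.trans_le (le_add_of_nonneg_left hu)

theorem orderTop_C_nonneg (a : ℝ) : 0 ≤ (HahnSeries.C a : HahnSeries ℚ ℝ).orderTop :=
  HahnSeries.orderTop_single_le

/-- The Hahn series `u` has no negative powers and constant term `a`. -/
def HasResidue (u : HahnSeries ℚ ℝ) (a : ℝ) : Prop := 0 < (u - HahnSeries.C a).orderTop

namespace HasResidue

variable {u v : HahnSeries ℚ ℝ} {a b : ℝ}

theorem orderTop_nonneg (hu : HasResidue u a) : 0 ≤ u.orderTop := by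
  rw [← sub_add_cancel u (HahnSeries.C a)]
  exact (le_min (le_of_lt hu) (orderTop_C_nonneg a)).trans
    HahnSeries.min_orderTop_le_orderTop_add

theorem const (a : ℝ) : HasResidue (HahnSeries.C a) a := by
  simp [HasResidue]

theorem zero : HasResidue 0 0 := by simp [HasResidue]

theorem add (hu : HasResidue u a) (hv : HasResidue v b) : HasResidue (u + v) (a + b) := by
  have := lt_orderTop_add hu hv
  rwa [HasResidue, map_add, add_sub_add_comm]

theorem mul (hu : HasResidue u a) (hv : HasResidue v b) : HasResidue (u * v) (a * b) := by
  have h : u * v - HahnSeries.C (a * b) =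
      u * (v - HahnSeries.C b) + HahnSeries.C b * (u - HahnSeries.C a) := by
    rw [map_mul]; ring
  rw [HasResidue, h]
  exact lt_orderTop_add (lt_orderTop_mul hu.orderTop_nonneg hv)
    (lt_orderTop_mul (orderTop_C_nonneg b) hu)

theorem single_pos {g : ℚ} (hg : 0 < g) (r : ℝ) : HasResidue (HahnSeries.single g r) 0 := by
  rw [HasResidue, map_zero, sub_zero]
  exact HahnSeries.lt_orderTop_single hg

theorem natCast (n : ℕ) : HasResidue (n : HahnSeries ℚ ℝ) n := by
  have := const (n : ℝ)
  rwa [map_natCast] at this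

theorem intCast (n : ℤ) : HasResidue (n : HahnSeries ℚ ℝ) n := by
  have := const (n : ℝ)
  rwa [map_intCast] at this

theorem sum {ι : Type*} (s : Finset ι) (f : ι → HahnSeries ℚ ℝ) (g : ι → ℝ)
    (h : ∀ i ∈ s, HasResidue (f i) (g i)) : HasResidue (∑ i ∈ s, f i) (∑ i ∈ s, g i) := by
  classical
  induction s using Finset.induction_on with
  | empty => simpa using zero
  | insert i s hi ih =>
    rw [Finset.sum_insert hi, Finset.sum_insert hi]
    exact (h i (by simp)).add (ih fun j hj => h j (by simp [hj]))

theorem prod {ι : Type*} (s : Finset ι) (f : ι → HahnSeries ℚ ℝ) (g : ι → ℝ)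
    (h : ∀ i ∈ s, HasResidue (f i) (g i)) : HasResidue (∏ i ∈ s, f i) (∏ i ∈ s, g i) := by
  classical
  induction s using Finset.induction_on with
  | empty => simpa using const 1
  | insert i s hi ih =>
    rw [Finset.prod_insert hi, Finset.prod_insert hi]
    exact (h i (by simp)).mul (ih fun j hj => h j (by simp [hj]))

theorem det {ι : Type*} [Fintype ι] [DecidableEq ι] (M : Matrix ι ι (HahnSeries ℚ ℝ))
    (N : Matrix ι ι ℝ) (h : ∀ i j, HasResidue (M i j) (N i j)) : HasResidue M.det N.det := by
  rw [Matrix.det_apply', Matrix.det_apply']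
  exact sum _ _ _ fun σ _ => (intCast _).mul (prod _ _ _ fun i _ => h _ _)

theorem ne_zero (hu : HasResidue u a) (ha : a ≠ 0) : u ≠ 0 := by
  rintro rfl
  have h : (0 - HahnSeries.C a : HahnSeries ℚ ℝ).coeff 0 = 0 :=
    HahnSeries.coeff_eq_zero_of_lt_orderTop hu
  simp [HahnSeries.C_apply] at h
  exact ha h

end HasResidue

/-! ### Invertibility of the Gram matrices -/

section GramMatrix

variable {α : ℚ} {d : ℝ}

theorem single_mul_cpow (α β : ℚ) (r : ℝ) :
    HahnSeries.single α 1 * cpow β r = HahnSeries.single (α - β) r := by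
  rw [cpow, HahnSeries.single_mul_single, one_mul, sub_eq_add_neg]

/-- One operator $L_m$ contributes at most one factor $H$, and $xH=d$. All other terms acquire an
unmatched $x$ or the factor $xc$, both of which vanish at $c=\infty$. -/
theorem hasResidue_applyL (hα : 1 < α) (w : List ℕ) :
    ∀ (φ : List ℕ → HahnSeries ℚ ℝ) (ψ : List ℕ → ℝ) (t : ℝ) (r : ℕ) (m : ℤ),
      (∀ v, HasResidue (HahnSeries.single α 1 ^ r * φ v) (t * ψ v)) →
      HasResidue (HahnSeries.single α 1 ^ (r + 1) * applyL (cpow 1 1) (cpow α d) φ m w)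
        (d * t * leadL ψ m w) := by
  have hx : HasResidue (HahnSeries.single α 1) 0 := .single_pos (by linarith) _
  have lower (r : ℕ) (u : HahnSeries ℚ ℝ) (a : ℝ)
      (hu : HasResidue (HahnSeries.single α 1 ^ r * u) a) :
      HasResidue (HahnSeries.single α 1 ^ (r + 1) * u) 0 := by
    have := hx.mul hu
    rwa [zero_mul, ← mul_assoc, ← pow_succ'] at this
  induction w with
  | nil =>
    intro φ ψ t r m hφ
    rw [applyL, leadL]
    split_ifs with h1 h2 h2
    · omega
    · rw [mul_zero]; exact lower _ _ _ (hφ _)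
    · have hH : HasResidue (HahnSeries.single α 1 * cpow α d) d := by
        rw [single_mul_cpow, sub_self]; exact .const d
      have := hH.mul (hφ [])
      convert this using 1 <;> ring
    · simpa using HasResidue.zero
  | cons k w ih =>
    intro φ ψ t r m hφ
    rw [applyL, leadL]
    split_ifs with h1 h2
    · rw [mul_zero]; exact lower _ _ _ (hφ _)
    · have hc : HasResidue (HahnSeries.single α 1 * cpow 1 1) 0 := by
        rw [single_mul_cpow]; exact .single_pos (by linarith) _
      have hk := (HasResidue.const (((m : ℝ) ^ 3 - m) / 12)).mul (hc.mul (hφ w))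
      have e : (HahnSeries.C (((m : ℝ) ^ 3 - m) / 12) : HahnSeries ℚ ℝ) =
          ((m : HahnSeries ℚ ℝ) ^ 3 - m) / 12 := by
        rw [eq_div_iff (by norm_num), ← map_ofNat (HahnSeries.C (Γ := ℚ) (R := ℝ)) 12, ← map_mul,
          div_mul_cancel₀ _ (by norm_num), map_sub, map_pow, map_intCast]
      rw [e] at hk
      have := ((ih _ _ t r m fun v => hφ (k :: v)).add
        (((HasResidue.intCast m).add (HasResidue.natCast k)).mul (ih φ ψ t r (m - k) hφ))).add hk
      convert this using 1 <;> ring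
    · have := (ih _ _ t r m fun v => hφ (k :: v)).add
        (((HasResidue.intCast m).add (HasResidue.natCast k)).mul (ih φ ψ t r (m - k) hφ))
      convert this using 1 <;> ring

theorem hasResidue_shapovalov (hα : 1 < α) (u : List ℕ) : ∀ w : List ℕ,
    HasResidue (HahnSeries.single α 1 ^ u.length * shapovalov (cpow 1 1) (cpow α d) u w)
      (d ^ u.length * leadForm u w) := by
  induction u with
  | nil =>
    intro w
    rw [shapovalov, leadForm]
    split_ifs
    · simpa using HasResidue.const 1
    · simpa using HasResidue.zero
  | cons k u ih =>
    intro w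
    have := hasResidue_applyL (d := d) hα w _ _ _ _ (k : ℤ) ih
    rwa [← pow_succ'] at this

/-- Scale each row by $x$ to the length of its word. The determinant then has residue a power of $d$
times that of the leading form, so it is non-zero at every level. -/
theorem det_gram_ne_zero (hα : 1 < α) (hd : d ≠ 0) (n : ℕ) :
    (gram (cpow 1 1) (cpow α d) n).det ≠ 0 := by
  have h := HasResidue.det
    (Matrix.of fun p q : n.Partition => HahnSeries.single α 1 ^ (partList p).length *
      gram (cpow 1 1) (cpow α d) n p q)
    (Matrix.of fun p q : n.Partition => d ^ (partList p).length *
      (Matrix.of fun p q : n.Partition => leadForm (partList p) (partList q)) p q)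
    fun p q => by simpa only [Matrix.of_apply, gram] using hasResidue_shapovalov hα _ _
  rw [Matrix.det_mul_column, Matrix.det_mul_column] at h
  exact right_ne_zero_of_mul (h.ne_zero (mul_ne_zero
    (Finset.prod_ne_zero_iff.2 fun p _ => pow_ne_zero _ hd) (det_leadForm_ne_zero n)))

end GramMatrix

/-! ### Expansions in `x = c ^ (-α)` and `y = c ^ (1 - α)` -/

/-- The map `ℕ → ℚ`, `j ↦ j (α - 1)`. -/
def scaleHom (α : ℚ) : ℕ →+ ℚ := (AddMonoidHom.mulRight (α - 1)).comp (Nat.castAddMonoidHom ℚ)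

theorem scaleHom_apply (α : ℚ) (j : ℕ) : scaleHom α j = j * (α - 1) := rfl

theorem scaleHom_le_iff {α : ℚ} (hα : 1 < α) (i j : ℕ) : scaleHom α i ≤ scaleHom α j ↔ i ≤ j := by
  rw [scaleHom_apply, scaleHom_apply, mul_le_mul_iff_left₀ (sub_pos.2 hα), Nat.cast_le]

theorem scaleHom_injective {α : ℚ} (hα : 1 < α) : Function.Injective (scaleHom α) :=
  fun i j h => le_antisymm ((scaleHom_le_iff hα i j).1 h.le) ((scaleHom_le_iff hα j i).1 h.ge)

/-- Substitution of `y = c ^ (1 - α)` into a power series. -/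
noncomputable def ofSeries {α : ℚ} (hα : 1 < α) : PowerSeries ℝ →+* HahnSeries ℚ ℝ :=
  (HahnSeries.embDomainRingHom (scaleHom α) (scaleHom_injective hα) (scaleHom_le_iff hα)).comp
    (HahnSeries.toPowerSeries.symm : PowerSeries ℝ ≃+* HahnSeries ℕ ℝ).toRingHom

section

variable {α : ℚ} (hα : 1 < α)

theorem coeff_ofSeries (G : PowerSeries ℝ) (j : ℕ) :
    (ofSeries hα G).coeff (j * (α - 1)) = PowerSeries.coeff j G :=
  HahnSeries.embDomain_coeff (f := ⟨⟨scaleHom α, scaleHom_injective hα⟩, scaleHom_le_iff hα _ _⟩)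

theorem coeff_ofSeries_of_forall_ne (G : PowerSeries ℝ) {q : ℚ}
    (hq : ∀ j : ℕ, q ≠ j * (α - 1)) : (ofSeries hα G).coeff q = 0 :=
  HahnSeries.embDomain_of_notMem_range
    (f := ⟨⟨scaleHom α, scaleHom_injective hα⟩, scaleHom_le_iff hα _ _⟩)
    (by rintro ⟨j, rfl⟩; exact hq j rfl)

theorem ofSeries_C (a : ℝ) : ofSeries hα (PowerSeries.C a) = HahnSeries.C a := by
  ext q
  by_cases hq : ∃ j : ℕ, q = j * (α - 1)
  · obtain ⟨j, rfl⟩ := hq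
    rw [coeff_ofSeries, PowerSeries.coeff_C, HahnSeries.C_apply, HahnSeries.coeff_single]
    simp [(sub_pos.2 hα).ne']
  · push Not at hq
    rw [coeff_ofSeries_of_forall_ne hα _ hq, HahnSeries.C_apply, HahnSeries.coeff_single_of_ne]
    simpa using hq 0

theorem ofSeries_X : ofSeries hα PowerSeries.X = HahnSeries.single (α - 1) 1 := by
  ext q
  by_cases hq : ∃ j : ℕ, q = j * (α - 1)
  · obtain ⟨j, rfl⟩ := hq
    rw [coeff_ofSeries, PowerSeries.coeff_X, HahnSeries.coeff_single]
    simp [(sub_pos.2 hα).ne']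
  · push Not at hq
    rw [coeff_ofSeries_of_forall_ne hα _ hq, HahnSeries.coeff_single_of_ne]
    simpa using hq 1

theorem orderTop_ofSeries_nonneg (G : PowerSeries ℝ) : 0 ≤ (ofSeries hα G).orderTop := by
  refine HahnSeries.le_orderTop_iff_forall.2 fun q hq => ?_
  refine coeff_ofSeries_of_forall_ne hα _ fun j hj => ?_
  have h0 : q < 0 := by exact_mod_cast hq
  have : 0 ≤ (j : ℚ) * (α - 1) := mul_nonneg j.cast_nonneg (sub_pos.2 hα).le
  linarith

theorem hasResidue_ofSeries (G : PowerSeries ℝ) :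
    HasResidue (ofSeries hα G) (PowerSeries.constantCoeff G) := by
  obtain ⟨G', hG'⟩ := PowerSeries.X_dvd_iff.2
    (show PowerSeries.constantCoeff (G - PowerSeries.C (PowerSeries.constantCoeff G)) = 0 by simp)
  rw [HasResidue, ← ofSeries_C hα, ← map_sub, hG', map_mul, mul_comm, ofSeries_X]
  exact lt_orderTop_mul (orderTop_ofSeries_nonneg hα _)
    (HahnSeries.lt_orderTop_single (sub_pos.2 hα))

theorem lt_orderTop_single_mul (r : ℝ) {u : HahnSeries ℚ ℝ} (hu : 0 < u.orderTop) :
    (α : WithTop ℚ) < (HahnSeries.single α r * u).orderTop := by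
  rw [HahnSeries.orderTop_mul]
  calc (α : WithTop ℚ) = α + 0 := (add_zero _).symm
    _ < α + u.orderTop := WithTop.add_lt_add_left WithTop.coe_ne_top hu
    _ ≤ _ := by gcongr; exact HahnSeries.orderTop_single_le

/-- `u = G(y) + r x + ⋯`, where the dots stand for powers of `c` below `x = c ^ (-α)`. -/
def HasExpansion (u : HahnSeries ℚ ℝ) (G : PowerSeries ℝ) (r : ℝ) : Prop :=
  (α : WithTop ℚ) < (u - ofSeries hα G - HahnSeries.single α r).orderTop

namespace HasExpansion

variable {hα} {u v : HahnSeries ℚ ℝ} {G G' : PowerSeries ℝ} {r s : ℝ}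

theorem of_eq (h : u = ofSeries hα G + HahnSeries.single α r) : HasExpansion hα u G r := by
  simp [HasExpansion, h]

theorem add (hu : HasExpansion hα u G r) (hv : HasExpansion hα v G' s) :
    HasExpansion hα (u + v) (G + G') (r + s) := by
  have := lt_orderTop_add hu hv
  rw [HasExpansion, map_add, HahnSeries.single_add]
  convert this using 2
  ring

theorem neg (hu : HasExpansion hα u G r) : HasExpansion hα (-u) (-G) (-r) := by
  have e : -u - -ofSeries hα G - -HahnSeries.single α r =
      -(u - ofSeries hα G - HahnSeries.single α r) := by ring
  rwa [HasExpansion, map_neg, HahnSeries.single_neg, e, HahnSeries.orderTop_neg]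

theorem hasResidue (hu : HasExpansion hα u G r) :
    HasResidue u (PowerSeries.constantCoeff G) := by
  have hpos : (0 : WithTop ℚ) < α := by exact_mod_cast zero_lt_one.trans hα
  have h1 : HasResidue (u - ofSeries hα G - HahnSeries.single α r) 0 := by
    rw [HasResidue, map_zero, sub_zero]
    exact hpos.trans hu
  have := (h1.add (HasResidue.single_pos (zero_lt_one.trans hα) r)).add (hasResidue_ofSeries hα G)
  simpa using this

/-- Since $xy$ and $x^2$ are $o(x)$, only the constant terms of the two series multiply $x$. -/
theorem mul (hu : HasExpansion hα u G r) (hv : HasExpansion hα v G' s) :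
    HasExpansion hα (u * v) (G * G')
      (PowerSeries.constantCoeff G * s + PowerSeries.constantCoeff G' * r) := by
  have hpos : (0 : WithTop ℚ) < α := by exact_mod_cast zero_lt_one.trans hα
  have hx (t : ℝ) : 0 < (HahnSeries.single α t : HahnSeries ℚ ℝ).orderTop :=
    HahnSeries.lt_orderTop_single (zero_lt_one.trans hα)
  have e (a b : ℝ) : HahnSeries.single α (a * b) = HahnSeries.C a * HahnSeries.single α b := by
    rw [HahnSeries.C_apply, HahnSeries.single_mul_single, zero_add]
  have key : u * v - ofSeries hα (G * G') - HahnSeries.single α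
      (PowerSeries.constantCoeff G * s + PowerSeries.constantCoeff G' * r) =
      u * (v - ofSeries hα G' - HahnSeries.single α s)
      + ofSeries hα G' * (u - ofSeries hα G - HahnSeries.single α r)
      + (HahnSeries.single α s * (u - HahnSeries.C (PowerSeries.constantCoeff G))
      + HahnSeries.single α r * (ofSeries hα G' -
        HahnSeries.C (PowerSeries.constantCoeff G'))) := by
    rw [map_mul, HahnSeries.single_add, e, e]
    ring
  rw [HasExpansion, key]
  refine lt_orderTop_add (lt_orderTop_add ?_ ?_) (lt_orderTop_add ?_ ?_)
  · exact lt_orderTop_mul hu.hasResidue.orderTop_nonneg hv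
  · exact lt_orderTop_mul (orderTop_ofSeries_nonneg hα _) hu
  · exact lt_orderTop_single_mul _ hu.hasResidue
  · exact lt_orderTop_single_mul _ (hasResidue_ofSeries hα _)

/-- The candidate $G^{-1}+sx$ satisfies $u\,(G^{-1}+sx)=1+o(x)$; multiplying by $u^{-1}$, which has
order zero, preserves the error. -/
theorem inv (hu : HasExpansion hα u G r) (hG : PowerSeries.constantCoeff G ≠ 0) :
    HasExpansion hα u⁻¹ G⁻¹ (-(r / PowerSeries.constantCoeff G ^ 2)) := by
  have hne := hu.hasResidue.ne_zero hG
  have hc : u.coeff 0 ≠ 0 := by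
    have h : (u - HahnSeries.C (PowerSeries.constantCoeff G)).coeff 0 = 0 :=
      HahnSeries.coeff_eq_zero_of_lt_orderTop hu.hasResidue
    rw [HahnSeries.coeff_sub, HahnSeries.C_apply, HahnSeries.coeff_single_same, sub_eq_zero] at h
    rwa [h]
  have h0 : u.orderTop = 0 :=
    le_antisymm (HahnSeries.orderTop_le_of_coeff_ne_zero hc) hu.hasResidue.orderTop_nonneg
  have hinv : 0 ≤ (u⁻¹).orderTop := by
    have h := HahnSeries.orderTop_mul u u⁻¹
    rw [mul_inv_cancel₀ hne, h0, zero_add, HahnSeries.orderTop_one] at h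
    exact h.le
  set s := -(r / PowerSeries.constantCoeff G ^ 2)
  have hv : HasExpansion hα (ofSeries hα G⁻¹ + HahnSeries.single α s) G⁻¹ s := of_eq rfl
  have huv := hu.mul hv
  have hs : PowerSeries.constantCoeff G * s + PowerSeries.constantCoeff G⁻¹ * r = 0 := by
    rw [PowerSeries.constantCoeff_inv]
    simp only [s]
    field_simp
    ring
  rw [hs, PowerSeries.mul_inv_cancel _ hG, HasExpansion, map_one, HahnSeries.single_eq_zero,
    sub_zero, ← HahnSeries.orderTop_neg] at huv
  have := lt_orderTop_mul hinv huv
  rw [HasExpansion]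
  convert this using 2
  field_simp
  ring

/-- The coefficients of `c ^ a`, `a ≥ 0`, in `f` with `x f = G(y) + r x + ⋯`. -/
theorem coeff_eq {f : HahnSeries ℚ ℝ} (hf : HasExpansion hα (HahnSeries.single α 1 * f) G r) {a : ℚ}
    (ha : 0 ≤ a) :
    f.coeff (-a) = (ofSeries hα G).coeff (α - a) + if a = 0 then r else 0 := by
  have h : (HahnSeries.single α 1 * f - ofSeries hα G - HahnSeries.single α r).coeff (α - a) = 0 := by
    -- The power $c^a$ in $f$ sits at order $\alpha-a\le\alpha$ in $xf$, below the error.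
    refine HahnSeries.coeff_eq_zero_of_lt_orderTop (lt_of_le_of_lt ?_ hf)
    exact_mod_cast sub_le_self α ha
  have h2 : (HahnSeries.single α 1 * f).coeff (α - a) = f.coeff (-a) := by
    rw [show α - a = -a + α by ring, HahnSeries.coeff_single_mul_add, one_mul]
  rw [HahnSeries.coeff_sub, HahnSeries.coeff_sub, h2, HahnSeries.coeff_single] at h
  simp only [sub_eq_self] at h
  linarith

end HasExpansion

end
/-! ### The expansion of the logarithmic block -/

section Homogeneity

variable {R : Type*} [CommRing R]

theorem kacTwoOne_smul (t H c e : R) :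
    kacTwoOne (t * H) (t * c) (t * e) = t ^ 2 * kacTwoOne H c e := by
  simp only [kacTwoOne]; ring

theorem kacFourOne_smul (t H c e : R) :
    kacFourOne (t * H) (t * c) (t * e) = t ^ 2 * kacFourOne H c e := by
  simp only [kacFourOne]; ring

theorem kacTwoTwo_smul (t H c e : R) :
    kacTwoTwo (t * H) (t * c) (t * e) = t * kacTwoTwo H c e := by
  simp only [kacTwoTwo]; ring

theorem logNumTwo_smul (t h H c e : R) :
    logNumTwo (t * h) (t * H) (t * c) (t * e) = t ^ 3 * logNumTwo h H c e := by
  simp only [logNumTwo]; ring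

theorem logNumFour_smul (t h H c e : R) :
    logNumFour (t * h) (t * H) (t * c) (t * e) = t ^ 8 * logNumFour h H c e := by
  simp only [logNumFour, logNumFourCoeff]; ring

section Map

variable {R' : Type*} [CommRing R'] (f : R →+* R') (h H c e : R)

theorem map_kacTwoOne : f (kacTwoOne H c e) = kacTwoOne (f H) (f c) (f e) := by
  simp [kacTwoOne, map_ofNat]

theorem map_kacFourOne : f (kacFourOne H c e) = kacFourOne (f H) (f c) (f e) := by
  simp [kacFourOne, map_ofNat]

theorem map_kacTwoTwo : f (kacTwoTwo H c e) = kacTwoTwo (f H) (f c) (f e) := by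
  simp [kacTwoTwo, map_ofNat]

theorem map_logNumTwo : f (logNumTwo h H c e) = logNumTwo (f h) (f H) (f c) (f e) := by
  simp [logNumTwo, map_ofNat]

theorem map_logNumFourCoeff (k : ℕ) :
    f (logNumFourCoeff H c e k) = logNumFourCoeff (f H) (f c) (f e) k := by
  rcases k with _ | _ | _ | _ | _ | k <;> simp [logNumFourCoeff, map_ofNat]

theorem map_logNumFour : f (logNumFour h H c e) = logNumFour (f h) (f H) (f c) (f e) := by
  simp [logNumFour, map_logNumFourCoeff]

end Map

variable (S : Subring R) {h H c e : R}

/-- Evaluating the polynomial inside the subring and including the value gives membership. -/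
theorem kacTwoOne_mem (hH : H ∈ S) (hc : c ∈ S) (he : e ∈ S) :
    kacTwoOne H c e ∈ S :=
  (map_kacTwoOne S.subtype ⟨H, hH⟩ ⟨c, hc⟩ ⟨e, he⟩) ▸ Subtype.property _

theorem kacFourOne_mem (hH : H ∈ S) (hc : c ∈ S) (he : e ∈ S) :
    kacFourOne H c e ∈ S :=
  (map_kacFourOne S.subtype ⟨H, hH⟩ ⟨c, hc⟩ ⟨e, he⟩) ▸ Subtype.property _

theorem kacTwoTwo_mem (hH : H ∈ S) (hc : c ∈ S) (he : e ∈ S) :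
    kacTwoTwo H c e ∈ S :=
  (map_kacTwoTwo S.subtype ⟨H, hH⟩ ⟨c, hc⟩ ⟨e, he⟩) ▸ Subtype.property _

theorem logNumTwo_mem (hh : h ∈ S) (hH : H ∈ S) (hc : c ∈ S) (he : e ∈ S) :
    logNumTwo h H c e ∈ S :=
  (map_logNumTwo S.subtype ⟨h, hh⟩ ⟨H, hH⟩ ⟨c, hc⟩ ⟨e, he⟩) ▸ Subtype.property _

theorem logNumFour_mem (hh : h ∈ S) (hH : H ∈ S) (hc : c ∈ S) (he : e ∈ S) :
    logNumFour h H c e ∈ S :=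
  (map_logNumFour S.subtype ⟨h, hh⟩ ⟨H, hH⟩ ⟨c, hc⟩ ⟨e, he⟩) ▸ Subtype.property _

end Homogeneity

/-- The exponents `α` of heavy dimensions. -/
abbrev HeavyExponent : Type := {α : ℚ // 1 < α}

/-- The families `u_α`, `α > 1`, with an expansion `u_α = G(y) + r x + ⋯` in which `G` and `r` do not
depend on `α`, together with the series `G`. -/
def expansionRing : Subring ((HeavyExponent → HahnSeries ℚ ℝ) × PowerSeries ℝ) where
  carrier := {t | ∃ r : ℝ, ∀ α : HeavyExponent, HasExpansion α.2 (t.1 α) t.2 r}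
  zero_mem' := ⟨0, fun _ => .of_eq (by simp)⟩
  one_mem' := ⟨0, fun _ => .of_eq (by simp)⟩
  add_mem' := by
    rintro s t ⟨a, ha⟩ ⟨b, hb⟩
    exact ⟨_, fun α => (ha α).add (hb α)⟩
  mul_mem' := by
    rintro s t ⟨a, ha⟩ ⟨b, hb⟩
    exact ⟨_, fun α => (ha α).mul (hb α)⟩
  neg_mem' := by
    rintro s ⟨a, ha⟩
    exact ⟨_, fun α => (ha α).neg⟩

/-- The constant family. -/
noncomputable def constFamily (a : ℝ) : (HeavyExponent → HahnSeries ℚ ℝ) × PowerSeries ℝ :=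
  (fun _ => HahnSeries.C a, PowerSeries.C a)

/-- The family `x = c ^ (-α)`. -/
noncomputable def xFamily : (HeavyExponent → HahnSeries ℚ ℝ) × PowerSeries ℝ :=
  (fun α => HahnSeries.single α.1 1, 0)

/-- The family `y = c ^ (1 - α)`. -/
noncomputable def yFamily : (HeavyExponent → HahnSeries ℚ ℝ) × PowerSeries ℝ :=
  (fun α => HahnSeries.single (α.1 - 1) 1, PowerSeries.X)

theorem constFamily_mem (a : ℝ) : constFamily a ∈ expansionRing :=
  ⟨0, fun α => .of_eq (by simp [constFamily, ofSeries_C])⟩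

theorem xFamily_mem : xFamily ∈ expansionRing :=
  ⟨1, fun α => .of_eq (by simp [xFamily])⟩

theorem yFamily_mem : yFamily ∈ expansionRing :=
  ⟨0, fun α => .of_eq (by simp [yFamily, ofSeries_X])⟩

/-- For a fixed $\alpha$ the series $G$ is not determined by $u$. It is carried as a second
component so that the condition on the denominator at $x=y=0$ makes sense. -/
theorem div_mem_expansionRing {s t : (HeavyExponent → HahnSeries ℚ ℝ) × PowerSeries ℝ}
    (hs : s ∈ expansionRing) (ht : t ∈ expansionRing) (h0 : PowerSeries.constantCoeff t.2 ≠ 0) :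
    ((fun α => s.1 α / t.1 α, s.2 * t.2⁻¹) :
      (HeavyExponent → HahnSeries ℚ ℝ) × PowerSeries ℝ) ∈ expansionRing := by
  obtain ⟨a, ha⟩ := hs
  obtain ⟨b, hb⟩ := ht
  simp only [div_eq_mul_inv]
  exact ⟨_, fun α => (ha α).mul ((hb α).inv h0)⟩

theorem ne_zero_of_mem_expansionRing {t : (HeavyExponent → HahnSeries ℚ ℝ) × PowerSeries ℝ}
    (ht : t ∈ expansionRing) (h0 : PowerSeries.constantCoeff t.2 ≠ 0) (α : HeavyExponent) :
    t.1 α ≠ 0 := by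
  obtain ⟨b, hb⟩ := ht
  exact (hb α).hasResidue.ne_zero h0

/-- The quadratic coefficient of the symmetrised logarithmic block. -/
noncomputable def symTwo {K : Type*} [Field K] (h H c : K) : K :=
  logNumTwo h H c 1 / (8 * kacTwoOne H c 1)

/-- The quartic coefficient of the symmetrised logarithmic block. -/
noncomputable def symFour {K : Type*} [Field K] (h H c : K) : K :=
  logNumFour h H c 1 / (64 * kacTwoOne H c 1 ^ 2 * kacFourOne H c 1 * kacTwoTwo H c 1)

/-! ### Rescaling of the logarithmic block by $x=c^{-\alpha}$ -/

section

variable {δt : ℝ} (δ : ℝ) (α : HeavyExponent)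

theorem x_mul_cpow (α : ℚ) (a : ℝ) : HahnSeries.single α 1 * cpow α a = HahnSeries.C a := by
  rw [single_mul_cpow, sub_self, HahnSeries.C_apply]

/-- Evaluation of the first component of a pair at `α`. -/
noncomputable def evalFst : (HeavyExponent → HahnSeries ℚ ℝ) × PowerSeries ℝ →+* HahnSeries ℚ ℝ :=
  (Pi.evalRingHom _ α).comp (RingHom.fst _ _)

theorem evalFst_apply (t : (HeavyExponent → HahnSeries ℚ ℝ) × PowerSeries ℝ) :
    evalFst α t = t.1 α := rfl

theorem evalFst_constFamily (a : ℝ) :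
    evalFst α (constFamily a) = HahnSeries.single α.1 1 * cpow α a := (x_mul_cpow _ _).symm

theorem evalFst_xFamily : evalFst α xFamily = HahnSeries.single α.1 1 * 1 := (mul_one _).symm

theorem evalFst_yFamily : evalFst α yFamily = HahnSeries.single α.1 1 * cpow 1 1 :=
  (single_mul_cpow _ _ _).symm

/-- The composition of the second component with the constant coefficient. -/
noncomputable def constSnd : (HeavyExponent → HahnSeries ℚ ℝ) × PowerSeries ℝ →+* ℝ :=
  PowerSeries.constantCoeff.comp (RingHom.snd _ _)

theorem constSnd_constFamily (a : ℝ) : constSnd (constFamily a) = a := by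
  simp [constSnd, constFamily]

theorem constSnd_xFamily : constSnd xFamily = 0 := by simp [constSnd, xFamily]

theorem constSnd_yFamily : constSnd yFamily = 0 := by simp [constSnd, yFamily]

theorem constSnd_kacTwoOne :
    constSnd (kacTwoOne (constFamily δt) yFamily xFamily) = 16 * δt ^ 2 := by
  rw [map_kacTwoOne, constSnd_constFamily, constSnd_xFamily, constSnd_yFamily, kacTwoOne]
  ring

theorem constSnd_kacFourOne :
    constSnd (kacFourOne (constFamily δt) yFamily xFamily) = 16 * δt ^ 2 := by
  rw [map_kacFourOne, constSnd_constFamily, constSnd_xFamily, constSnd_yFamily, kacFourOne]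
  ring

theorem constSnd_kacTwoTwo :
    constSnd (kacTwoTwo (constFamily δt) yFamily xFamily) = 8 * δt := by
  rw [map_kacTwoTwo, constSnd_constFamily, constSnd_xFamily, constSnd_yFamily, kacTwoTwo]
  ring

/-- By homogeneity $x^2$ times this factor is its value at $(\tilde\delta,y,x)$, with residue
$16\tilde\delta^2$. -/
theorem kacTwoOne_cpow_ne_zero (hδ : δt ≠ 0) : kacTwoOne (cpow α δt) (cpow 1 1) 1 ≠ 0 := by
  have h := ne_zero_of_mem_expansionRing
    (kacTwoOne_mem expansionRing (constFamily_mem δt) yFamily_mem xFamily_mem)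
    (show constSnd _ ≠ 0 by rw [constSnd_kacTwoOne]; positivity) α
  rw [← evalFst_apply, map_kacTwoOne, evalFst_constFamily, evalFst_xFamily, evalFst_yFamily,
    kacTwoOne_smul] at h
  exact right_ne_zero_of_mul h

theorem kacFourOne_cpow_ne_zero (hδ : δt ≠ 0) : kacFourOne (cpow α δt) (cpow 1 1) 1 ≠ 0 := by
  have h := ne_zero_of_mem_expansionRing
    (kacFourOne_mem expansionRing (constFamily_mem δt) yFamily_mem xFamily_mem)
    (show constSnd _ ≠ 0 by rw [constSnd_kacFourOne]; positivity) α
  rw [← evalFst_apply, map_kacFourOne, evalFst_constFamily, evalFst_xFamily, evalFst_yFamily,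
    kacFourOne_smul] at h
  exact right_ne_zero_of_mul h

theorem kacTwoTwo_cpow_ne_zero (hδ : δt ≠ 0) : kacTwoTwo (cpow α δt) (cpow 1 1) 1 ≠ 0 := by
  have h := ne_zero_of_mem_expansionRing
    (kacTwoTwo_mem expansionRing (constFamily_mem δt) yFamily_mem xFamily_mem)
    (show constSnd _ ≠ 0 by rw [constSnd_kacTwoTwo]; positivity) α
  rw [← evalFst_apply, map_kacTwoTwo, evalFst_constFamily, evalFst_xFamily, evalFst_yFamily,
    kacTwoTwo_smul] at h
  exact right_ne_zero_of_mul h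

theorem two_mul_cpow_add_ne_zero (hδ : δt ≠ 0) (k : ℕ) : 2 * cpow α δt + (k : HahnSeries ℚ ℝ) ≠ 0 := by
  have h := ((HasResidue.natCast 2).mul (HasResidue.const δt)).add
    ((HasResidue.single_pos (zero_lt_one.trans α.2) 1).mul (HasResidue.natCast k))
  have h' := h.ne_zero (by simpa using hδ)
  intro h0
  apply h'
  rw [← x_mul_cpow α]
  linear_combination HahnSeries.single α.1 1 * h0

/-- The logarithmic block up to fifth order. -/
theorem coeff_logBlock (hδ : δt ≠ 0) :
    PowerSeries.coeff 0 (logBlock α δ δt) = 0 ∧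
    PowerSeries.coeff 1 (logBlock α δ δt) = cpow α δt / 2 ∧
    PowerSeries.coeff 2 (logBlock α δ δt) =
      cpow α δt / 4 + symTwo (cpow α δ) (cpow α δt) (cpow 1 1) ∧
    PowerSeries.coeff 3 (logBlock α δ δt) =
      cpow α δt / 6 + symTwo (cpow α δ) (cpow α δt) (cpow 1 1) ∧
    PowerSeries.coeff 4 (logBlock α δ δt) =
      cpow α δt / 8 + symTwo (cpow α δ) (cpow α δt) (cpow 1 1)
        + symFour (cpow α δ) (cpow α δt) (cpow 1 1) ∧
    PowerSeries.coeff 5 (logBlock α δ δt) =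
      cpow α δt / 10 + symTwo (cpow α δ) (cpow α δt) (cpow 1 1)
        + 2 * symFour (cpow α δ) (cpow α δt) (cpow 1 1) := by
  unfold logBlock
  exact @coeff_logOf_block (HahnSeries ℚ ℝ) _ _ (HahnSeries.powerSeriesAlgebra ℚ ℝ) (cpow α δ)
    (cpow α δt) (cpow 1 1)
    (fun n _ => det_gram_ne_zero α.2 hδ n)
    (by simpa using two_mul_cpow_add_ne_zero α hδ 1)
    (by simpa using two_mul_cpow_add_ne_zero α hδ 3)
    (by simpa using two_mul_cpow_add_ne_zero α hδ 5) (kacTwoOne_cpow_ne_zero α hδ)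
    (kacFourOne_cpow_ne_zero α hδ) (kacTwoTwo_cpow_ne_zero α hδ) _ _ rfl rfl

/-- Degrees $3$ and $2$ of numerator and denominator make one factor $x$ suffice. The series is
explicit because the coefficient of $z^2$ is evaluated below; for `symFour` (degrees $8$ and $7$)
existence is enough. -/
theorem symTwo_mem (hδ : δt ≠ 0) :
    ((fun α => HahnSeries.single α.1 1 * symTwo (cpow α.1 δ) (cpow α.1 δt) (cpow 1 1),
      logNumTwo (PowerSeries.C δ) (PowerSeries.C δt) PowerSeries.X 0 *
        (8 * kacTwoOne (PowerSeries.C δt) PowerSeries.X 0)⁻¹) :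
      (HeavyExponent → HahnSeries ℚ ℝ) × PowerSeries ℝ) ∈ expansionRing := by
  have hden : 8 * kacTwoOne (constFamily δt) yFamily xFamily ∈ expansionRing :=
    mul_mem (ofNat_mem expansionRing 8)
      (kacTwoOne_mem expansionRing (constFamily_mem δt) yFamily_mem xFamily_mem)
  have h0 : constSnd (8 * kacTwoOne (constFamily δt) yFamily xFamily) ≠ 0 := by
    rw [map_mul, constSnd_kacTwoOne, map_ofNat]; positivity
  have h := div_mem_expansionRing (logNumTwo_mem expansionRing (constFamily_mem δ)
    (constFamily_mem δt) yFamily_mem xFamily_mem) hden h0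
  convert h using 2
  · funext α
    rw [← evalFst_apply, ← evalFst_apply, map_mul, map_logNumTwo, map_kacTwoOne, map_ofNat,
      evalFst_constFamily, evalFst_constFamily, evalFst_xFamily, evalFst_yFamily, logNumTwo_smul,
      kacTwoOne_smul, symTwo]
    have := kacTwoOne_cpow_ne_zero α hδ
    have hx : HahnSeries.single α.1 (1 : ℝ) ≠ 0 := HahnSeries.single_ne_zero one_ne_zero
    field_simp
  · have h1 := map_logNumTwo (RingHom.snd (HeavyExponent → HahnSeries ℚ ℝ) (PowerSeries ℝ))
      (constFamily δ) (constFamily δt) yFamily xFamily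
    have h2 := map_kacTwoOne (RingHom.snd (HeavyExponent → HahnSeries ℚ ℝ) (PowerSeries ℝ))
      (constFamily δt) yFamily xFamily
    rw [Prod.snd_mul, show (logNumTwo (constFamily δ) (constFamily δt) yFamily xFamily).2 = _ from h1,
      show (kacTwoOne (constFamily δt) yFamily xFamily).2 = _ from h2]
    rfl

theorem symFour_mem (hδ : δt ≠ 0) : ∃ G : PowerSeries ℝ,
    ((fun α => HahnSeries.single α.1 1 * symFour (cpow α.1 δ) (cpow α.1 δt) (cpow 1 1), G) :
      (HeavyExponent → HahnSeries ℚ ℝ) × PowerSeries ℝ) ∈ expansionRing := by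
  have hden : 64 * kacTwoOne (constFamily δt) yFamily xFamily ^ 2 *
      kacFourOne (constFamily δt) yFamily xFamily * kacTwoTwo (constFamily δt) yFamily xFamily ∈
      expansionRing :=
    mul_mem (mul_mem (mul_mem (ofNat_mem expansionRing 64)
      (pow_mem (kacTwoOne_mem expansionRing (constFamily_mem δt) yFamily_mem xFamily_mem) 2))
      (kacFourOne_mem expansionRing (constFamily_mem δt) yFamily_mem xFamily_mem))
      (kacTwoTwo_mem expansionRing (constFamily_mem δt) yFamily_mem xFamily_mem)
  have h0 : constSnd (64 * kacTwoOne (constFamily δt) yFamily xFamily ^ 2 *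
      kacFourOne (constFamily δt) yFamily xFamily *
      kacTwoTwo (constFamily δt) yFamily xFamily) ≠ 0 := by
    rw [map_mul, map_mul, map_mul, map_pow, constSnd_kacTwoOne, constSnd_kacFourOne,
      constSnd_kacTwoTwo, map_ofNat]
    positivity
  have h := div_mem_expansionRing (logNumFour_mem expansionRing (constFamily_mem δ)
    (constFamily_mem δt) yFamily_mem xFamily_mem) hden h0
  obtain ⟨r, hr⟩ := h
  refine ⟨_, r, fun α => Eq.subst (motive := fun u => HasExpansion α.2 u _ r) ?_ (hr α)⟩
  simp only
  rw [← evalFst_apply, ← evalFst_apply, map_mul, map_mul, map_mul, map_pow, map_logNumFour,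
    map_kacTwoOne, map_kacFourOne, map_kacTwoTwo, map_ofNat, evalFst_constFamily,
    evalFst_constFamily, evalFst_xFamily, evalFst_yFamily, logNumFour_smul, kacTwoOne_smul,
    kacFourOne_smul, kacTwoTwo_smul, symFour]
  have h1 := kacTwoOne_cpow_ne_zero α hδ
  have h2 := kacFourOne_cpow_ne_zero α hδ
  have h3 := kacTwoTwo_cpow_ne_zero α hδ
  have hx : HahnSeries.single α.1 (1 : ℝ) ≠ 0 := HahnSeries.single_ne_zero one_ne_zero
  field_simp

end
theorem x_mul_cpow_div (α : ℚ) (a q : ℝ) :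
    HahnSeries.single α 1 * (cpow α a * HahnSeries.C q) = HahnSeries.C (a * q) := by
  rw [← mul_assoc, x_mul_cpow, ← map_mul]

theorem C_inv_ofNat (n : ℕ) [n.AtLeastTwo] :
    (HahnSeries.C ((OfNat.ofNat n : ℝ)⁻¹) : HahnSeries ℚ ℝ) = (OfNat.ofNat n : HahnSeries ℚ ℝ)⁻¹ := by
  rw [map_inv₀, map_ofNat]

/-- Every coefficient of the logarithmic block up to fifth order has an expansion
`x f = G(y) + r x + ⋯` with `G` and `r` independent of `α`. -/
theorem exists_expansion (d : ClassicalDims) {n : ℕ} (hn : n < 6) :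
    ∃ (G : PowerSeries ℝ) (r : ℝ), ∀ (α : ℚ) (hα : 1 < α), HasExpansion hα
      (HahnSeries.single α 1 * PowerSeries.coeff n (logBlock α d.1.1 d.1.2)) G r := by
  obtain ⟨⟨δ, δt⟩, hδ⟩ := d
  change δt ≠ 0 at hδ
  have h2 := symTwo_mem δ hδ
  obtain ⟨G4, h4⟩ := symFour_mem δ hδ
  -- All six coefficients have the shape $qH+k\,s_2+m\,s_4$.
  have main (q k : ℝ) (m : ℕ) (f : HeavyExponent → HahnSeries ℚ ℝ)
      (hf : ∀ α : HeavyExponent, f α = cpow α δt * HahnSeries.C q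
        + HahnSeries.C k * symTwo (cpow α δ) (cpow α δt) (cpow 1 1)
        + (m : HahnSeries ℚ ℝ) * symFour (cpow α δ) (cpow α δt) (cpow 1 1)) :
      ∃ (G : PowerSeries ℝ) (r : ℝ), ∀ (α : ℚ) (hα : 1 < α), HasExpansion hα
        (HahnSeries.single α 1 * f ⟨α, hα⟩) G r := by
    obtain ⟨r, hr⟩ := add_mem (add_mem (constFamily_mem (δt * q)) (mul_mem (constFamily_mem k) h2))
      (mul_mem (natCast_mem expansionRing m) h4)
    refine ⟨_, r, fun α hα =>
      Eq.subst (motive := fun u => HasExpansion hα u _ r) ?_ (hr ⟨α, hα⟩)⟩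
    rw [hf]
    simp only [Prod.fst_add, Prod.fst_mul, Pi.add_apply, Pi.mul_apply, Prod.fst_natCast,
      Pi.natCast_apply, constFamily]
    rw [← x_mul_cpow_div α]
    ring
  have hl := fun α : HeavyExponent => coeff_logBlock δ α hδ
  interval_cases n
  · exact main 0 0 0 (fun α => PowerSeries.coeff 0 (logBlock α δ δt)) fun α => by
      simp [(hl α).1]
  · exact main 2⁻¹ 0 0 (fun α => PowerSeries.coeff 1 (logBlock α δ δt)) fun α => by
      rw [(hl α).2.1, C_inv_ofNat]; simp [div_eq_mul_inv]
  · exact main 4⁻¹ 1 0 (fun α => PowerSeries.coeff 2 (logBlock α δ δt)) fun α => by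
      rw [(hl α).2.2.1, C_inv_ofNat]; simp [div_eq_mul_inv]
  · exact main 6⁻¹ 1 0 (fun α => PowerSeries.coeff 3 (logBlock α δ δt)) fun α => by
      rw [(hl α).2.2.2.1, C_inv_ofNat]; simp [div_eq_mul_inv]
  · exact main 8⁻¹ 1 1 (fun α => PowerSeries.coeff 4 (logBlock α δ δt)) fun α => by
      rw [(hl α).2.2.2.2.1, C_inv_ofNat]; simp [div_eq_mul_inv]
  · exact main 10⁻¹ 1 2 (fun α => PowerSeries.coeff 5 (logBlock α δ δt)) fun α => by
      rw [(hl α).2.2.2.2.2, C_inv_ofNat]; simp [div_eq_mul_inv]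

/-! ### Two particular points -/

/-- The dimensions `δ = δt = 1`. -/
def dimsOne : ClassicalDims := ⟨(1, 1), one_ne_zero⟩

/-- The dimensions `δ = -1 / 4`, `δt = 1`, at which the level-two factor `δ + δt / 4` vanishes. -/
noncomputable def dimsSpecial : ClassicalDims := ⟨(-1 / 4, 1), one_ne_zero⟩

/-- Here $G=\frac14+\frac{42-y}{8(16+2y)}=\frac{37/4+3y/8}{16+2y}$. The value of $r$ is immaterial,
as only differences of constant terms are used. -/
theorem expansion_dimsOne : ∃ (G : PowerSeries ℝ) (r : ℝ),
    (∀ j : ℕ, 1 ≤ j → PowerSeries.coeff j G = 25 / 64 * (-1 / 8) ^ j) ∧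
    PowerSeries.coeff 0 G = 37 / 64 ∧
    ∀ (α : ℚ) (hα : 1 < α), HasExpansion hα
      (HahnSeries.single α 1 * PowerSeries.coeff 2 (logBlock α dimsOne.1.1 dimsOne.1.2)) G r := by
  obtain ⟨r, hr⟩ := add_mem (constFamily_mem (1 / 4)) (symTwo_mem 1 (one_ne_zero (α := ℝ)))
  have hden : PowerSeries.constantCoeff
      (8 * kacTwoOne (PowerSeries.C (1 : ℝ)) PowerSeries.X 0) ≠ 0 := by
    simp [kacTwoOne, map_ofNat]
  have e8 : (8 : PowerSeries ℝ) = PowerSeries.C 8 := (map_ofNat _ 8).symm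
  have e16 : (16 : PowerSeries ℝ) = PowerSeries.C 16 := (map_ofNat _ 16).symm
  have e2 : (2 : PowerSeries ℝ) = PowerSeries.C 2 := (map_ofNat _ 2).symm
  set G : PowerSeries ℝ := PowerSeries.C (1 / 4) + logNumTwo (PowerSeries.C 1) (PowerSeries.C 1)
    PowerSeries.X 0 * (8 * kacTwoOne (PowerSeries.C 1) PowerSeries.X 0)⁻¹ with hG
  have hmul : G * (PowerSeries.C 16 + PowerSeries.C 2 * PowerSeries.X) =
      PowerSeries.C (37 / 4) + PowerSeries.C (3 / 8) * PowerSeries.X := by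
    have h1 : (8 * kacTwoOne (PowerSeries.C (1 : ℝ)) PowerSeries.X 0)⁻¹ *
        (8 * kacTwoOne (PowerSeries.C (1 : ℝ)) PowerSeries.X 0) = 1 :=
      PowerSeries.inv_mul_cancel _ hden
    have h2 : PowerSeries.C (1 / 8 : ℝ) * 8 = 1 := by rw [e8, ← map_mul]; norm_num
    have h3 : PowerSeries.C (1 / 4 : ℝ) = 2 * PowerSeries.C (1 / 8 : ℝ) := by
      rw [e2, ← map_mul]; norm_num
    have h4 : PowerSeries.C (37 / 4 : ℝ) = 74 * PowerSeries.C (1 / 8 : ℝ) := by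
      rw [← map_ofNat (PowerSeries.C (R := ℝ)) 74, ← map_mul]; norm_num
    have h5 : PowerSeries.C (3 / 8 : ℝ) = 3 * PowerSeries.C (1 / 8 : ℝ) := by
      rw [← map_ofNat (PowerSeries.C (R := ℝ)) 3, ← map_mul]; norm_num
    rw [hG, h3, h4, h5, ← e16, ← e2]
    generalize (8 * kacTwoOne (PowerSeries.C (1 : ℝ)) PowerSeries.X 0)⁻¹ = I at *
    simp only [kacTwoOne, logNumTwo, map_one] at *
    linear_combination (42 - PowerSeries.X) * PowerSeries.C (1 / 8 : ℝ) * h1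
      - (42 - PowerSeries.X) * I * (16 + 2 * PowerSeries.X) * h2
  have hcoeff (j : ℕ) : PowerSeries.coeff (j + 1) G * 16 + PowerSeries.coeff j G * 2 =
      if j = 0 then 3 / 8 else 0 := by
    have h := congrArg (PowerSeries.coeff (j + 1)) hmul
    rw [mul_add, map_add, ← mul_assoc, PowerSeries.coeff_succ_mul_X, PowerSeries.coeff_mul_C,
      PowerSeries.coeff_mul_C, map_add (_ : PowerSeries ℝ →ₗ[ℝ] ℝ) (PowerSeries.C (37 / 4)),
      PowerSeries.coeff_succ_mul_X, PowerSeries.coeff_C, PowerSeries.coeff_C, if_neg (Nat.succ_ne_zero j), zero_add] at h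
    exact h
  have h0 : PowerSeries.coeff 0 G = 37 / 64 := by
    have h := congrArg PowerSeries.constantCoeff hmul
    simp only [map_mul, map_add, PowerSeries.constantCoeff_C, PowerSeries.constantCoeff_X, mul_zero,
      add_zero] at h
    rw [PowerSeries.coeff_zero_eq_constantCoeff_apply]
    linarith
  refine ⟨G, r, fun j hj => ?_, h0, fun α hα => ?_⟩
  · induction j, hj using Nat.le_induction with
    | base =>
      have := hcoeff 0
      rw [if_pos rfl, h0] at this
      linarith
    | succ j hj ih =>
      have := hcoeff j
      rw [if_neg (by omega), ih] at this
      rw [pow_succ]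
      linarith
  · refine Eq.subst (motive := fun u => HasExpansion hα u _ r) ?_ (hr ⟨α, hα⟩)
    have := (coeff_logBlock 1 ⟨α, hα⟩ (one_ne_zero (α := ℝ))).2.2.1
    simp only [dimsOne, this, Prod.fst_add, Pi.add_apply, constFamily]
    rw [← one_mul (1 / 4 : ℝ), ← x_mul_cpow_div α, one_div, C_inv_ofNat]
    ring

/-- For $h=-H/4$ the numerator of $s_2$ is divisible by the Kac factor $A$ up to terms of order $e$.
After rescaling, $xf=\frac3{16}+x\,\frac{8+y}{16A}$ with $A=16$ at $x=y=0$. -/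
theorem expansion_dimsSpecial (α : ℚ) (hα : 1 < α) : HasExpansion hα
    (HahnSeries.single α 1 *
      PowerSeries.coeff 2 (logBlock α dimsSpecial.1.1 dimsSpecial.1.2))
    (PowerSeries.C (3 / 16)) (1 / 32) := by
  have hden : 16 * kacTwoOne (constFamily 1) yFamily xFamily ∈ expansionRing :=
    mul_mem (ofNat_mem expansionRing 16)
      (kacTwoOne_mem expansionRing (constFamily_mem 1) yFamily_mem xFamily_mem)
  have hc0 : constSnd (16 * kacTwoOne (constFamily 1) yFamily xFamily) = 256 := by
    rw [map_mul, constSnd_kacTwoOne, map_ofNat]; norm_num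
  obtain ⟨r, hr⟩ := div_mem_expansionRing (add_mem (constFamily_mem 8) yFamily_mem) hden
    (show constSnd _ ≠ 0 by rw [hc0]; norm_num)
  have hx : HasExpansion hα (HahnSeries.single α 1) 0 1 := .of_eq (by simp)
  have hk : HasExpansion hα (HahnSeries.C (3 / 16)) (PowerSeries.C (3 / 16)) 0 :=
    .of_eq (by simp [ofSeries_C])
  have h := hk.add (hx.mul (hr ⟨α, hα⟩))
  have hconst : PowerSeries.constantCoeff ((constFamily 8 + yFamily).2 *
      (16 * kacTwoOne (constFamily 1) yFamily xFamily).2⁻¹) = 1 / 32 := by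
    have h1 : PowerSeries.constantCoeff (16 * kacTwoOne (constFamily 1) yFamily xFamily).2 = 256 :=
      hc0
    have h2 : PowerSeries.constantCoeff (constFamily 8 + yFamily).2 = 8 := by
      change constSnd (constFamily 8 + yFamily) = 8
      rw [map_add, constSnd_constFamily, constSnd_yFamily, add_zero]
    rw [map_mul, PowerSeries.constantCoeff_inv, h1, h2]
    norm_num
  simp only [hconst, map_zero, zero_mul, zero_add, add_zero, mul_one] at h
  refine Eq.subst (motive := fun u => HasExpansion hα u _ _) ?_ h
  have hl := (coeff_logBlock (-1 / 4) ⟨α, hα⟩ (one_ne_zero (α := ℝ))).2.2.1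
  have hA := kacTwoOne_cpow_ne_zero ⟨α, hα⟩ (one_ne_zero (α := ℝ))
  have hx0 : HahnSeries.single α (1 : ℝ) ≠ 0 := HahnSeries.single_ne_zero one_ne_zero
  have hH : HahnSeries.single α 1 * cpow α 1 = 1 := by rw [x_mul_cpow, map_one]
  have hh : cpow α (-1 / 4) = -(cpow α 1 / 4) := by
    apply mul_left_cancel₀ hx0
    have e : (HahnSeries.C (-1 / 4 : ℝ) : HahnSeries ℚ ℝ) = -(1 / 4) := by
      rw [neg_div, map_neg, one_div, C_inv_ofNat, one_div]
    rw [x_mul_cpow, e]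
    linear_combination hH / 4
  have e3 : (HahnSeries.C (3 / 16 : ℝ) : HahnSeries ℚ ℝ) = 3 / 16 := by
    rw [div_eq_mul_inv, map_mul, C_inv_ofNat, map_ofNat, div_eq_mul_inv]
  have e8 : evalFst ⟨α, hα⟩ (constFamily 8) = 8 := map_ofNat (HahnSeries.C (Γ := ℚ) (R := ℝ)) 8
  simp only [dimsSpecial, hl]
  rw [← evalFst_apply, ← evalFst_apply, map_add, map_mul, map_ofNat, map_kacTwoOne, e8,
    evalFst_constFamily, evalFst_xFamily, evalFst_yFamily, kacTwoOne_smul, symTwo, e3, hh]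
  generalize cpow 1 1 = c at *
  simp only at *
  generalize cpow α 1 = H at *
  generalize HahnSeries.single α (1 : ℝ) = x at *
  obtain rfl : H = x⁻¹ := eq_inv_of_mul_eq_one_right hH
  obtain ⟨A, eA⟩ : ∃ A, A = kacTwoOne x⁻¹ c 1 := ⟨_, rfl⟩
  rw [← eA] at hA ⊢
  rw [← sub_eq_zero]
  have key : A = 16 * x⁻¹ ^ 2 - 10 * x⁻¹ + 2 * c * x⁻¹ + c := by rw [eA, kacTwoOne]; ring
  simp only [logNumTwo]
  field_simp
  rw [key]
  field_simp
  ring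

/-! ### Exponents -/

theorem expo_eq (α : ℚ) (j : ℕ) : expo α j = α - j * (α - 1) := by
  unfold expo; ring

theorem expo_injective {α : ℚ} (hα : 1 < α) : Function.Injective (expo α) := by
  intro i j h
  rw [expo_eq, expo_eq] at h
  have h' : (i : ℚ) = j := mul_right_cancel₀ (sub_ne_zero.mpr hα.ne') (by linarith)
  exact_mod_cast h'

theorem expo_le_expo {α : ℚ} (hα : 1 < α) {i j : ℕ} (h : i ≤ j) : expo α j ≤ expo α i := by
  have h' : (i : ℚ) ≤ j := by exact_mod_cast h
  rw [expo_eq, expo_eq]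
  nlinarith

theorem one_lt_of_mem_interval {N : ℕ} (hN : 1 ≤ N) {α : ℚ} (h : α ∈ interval N) : 1 < α := by
  have hN' : (0 : ℚ) < N := by exact_mod_cast hN
  refine lt_of_lt_of_le ?_ h.1
  rw [lt_div_iff₀ hN']
  linarith

theorem expo_pos_of_mem_interval {N : ℕ} (hN : 1 ≤ N) {α : ℚ} (h : α ∈ interval N) :
    0 < expo α N := by
  rcases h.2 with rfl | h2
  · simp [expo]
  · rcases hN.eq_or_lt with rfl | hN
    · simp [expo]
    · have hN' : (0 : ℚ) < (N : ℚ) - 1 := by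
        rw [sub_pos]; exact_mod_cast hN
      rw [lt_div_iff₀ hN'] at h2
      rw [expo]
      linarith

theorem expo_succ_nonpos_of_mem_interval {N : ℕ} (hN : 1 ≤ N) {α : ℚ} (h : α ∈ interval N) :
    expo α (N + 1) ≤ 0 := by
  have hN' : (0 : ℚ) < N := by exact_mod_cast hN
  have h1 := h.1
  rw [div_le_iff₀ hN'] at h1
  rw [expo]
  push_cast
  linarith

/-- The exponents decrease in $j$, and the end points of the interval say that the $N$-th is
positive and the next is not. -/
theorem expo_pos_iff {N : ℕ} (hN : 1 ≤ N) {α : ℚ} (h : α ∈ interval N) {j : ℕ} :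
    0 < expo α j ↔ j ≤ N := by
  have hα := one_lt_of_mem_interval hN h
  refine ⟨fun hj => ?_, fun hj =>
    (expo_pos_of_mem_interval hN h).trans_le (expo_le_expo hα hj)⟩
  by_contra hlt
  exact absurd ((expo_le_expo hα (not_le.mp hlt)).trans
    (expo_succ_nonpos_of_mem_interval hN h)) hj.not_ge

theorem one_lt_exceptional {N : ℕ} (hN : 1 ≤ N) : 1 < exceptional N := by
  have hN' : (0 : ℚ) < N := by exact_mod_cast hN
  rw [exceptional, lt_div_iff₀ hN']
  linarith

theorem expo_exceptional {N : ℕ} (hN : 1 ≤ N) : expo (exceptional N) (N + 1) = 0 := by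
  have hN' : (N : ℚ) ≠ 0 := by exact_mod_cast (by omega : N ≠ 0)
  rw [expo, exceptional]
  push_cast
  field_simp
  ring

/-- The exponents for $j=0,1$ are $\alpha$ and $1$; for $j\ge2$ the exponent vanishes only at
$\alpha=j/(j-1)$, an exceptional point. -/
theorem RegularPoint.expo_ne_zero {α : ℚ} (h : RegularPoint α) (j : ℕ) : expo α j ≠ 0 := by
  intro h0
  rcases j with _ | _ | j
  · simp [expo] at h0
    linarith [h.1]
  · simp [expo] at h0
  · refine h.2 (j + 1) (by omega) ?_
    rw [expo] at h0
    push_cast at h0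
    have : (j : ℚ) + 1 ≠ 0 := by positivity
    rw [exceptional, eq_div_iff (by push_cast; exact this)]
    push_cast
    linarith

/-! ### Coefficients of non-negative powers of `c` -/

theorem coeff_coeffFun (α a : ℚ) (d : ClassicalDims) {n : ℕ} (hn : n < 6) :
    (coeffFun α a d).coeff n = (PowerSeries.coeff n (logBlock α d.1.1 d.1.2)).coeff (-a) := by
  rw [coeffFun, PowerSeries.coeff_trunc, if_pos hn, PowerSeries.coeff_mk]

theorem coeffFun_ext {α α' a a' : ℚ}
    (h : ∀ (d : ClassicalDims) (n : ℕ), n < 6 →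
      (PowerSeries.coeff n (logBlock α d.1.1 d.1.2)).coeff (-a) =
        (PowerSeries.coeff n (logBlock α' d.1.1 d.1.2)).coeff (-a')) :
    coeffFun α a = coeffFun α' a' := by
  ext d n
  by_cases hn : n < 6
  · rw [coeff_coeffFun _ _ _ hn, coeff_coeffFun _ _ _ hn, h d n hn]
  · rw [coeffFun, coeffFun, PowerSeries.coeff_trunc, PowerSeries.coeff_trunc, if_neg hn, if_neg hn]

section

variable {α : ℚ} {hα : 1 < α} {f : HahnSeries ℚ ℝ} {G : PowerSeries ℝ} {r : ℝ}

/-- When the exponent is zero, $y^j=x$ and both coefficients add up; this is the origin of the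
exceptional points. -/
theorem HasExpansion.coeff_expo (hf : HasExpansion hα (HahnSeries.single α 1 * f) G r) {j : ℕ}
    (hj : 0 ≤ expo α j) :
    f.coeff (-expo α j) = PowerSeries.coeff j G + if expo α j = 0 then r else 0 := by
  rw [hf.coeff_eq hj, ← coeff_ofSeries hα G j, expo_eq, sub_sub_cancel]

theorem HasExpansion.coeff_of_forall_ne (hf : HasExpansion hα (HahnSeries.single α 1 * f) G r)
    {a : ℚ} (ha : 0 ≤ a) (h : ∀ j, a ≠ expo α j) :
    f.coeff (-a) = if a = 0 then r else 0 := by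
  rw [hf.coeff_eq ha, coeff_ofSeries_of_forall_ne hα G, zero_add]
  intro j hj
  apply h j
  rw [expo_eq]
  linarith

end

theorem coeff_eq_zero_of_forall_ne {N : ℕ} (hN : 1 ≤ N) {α : ℚ} (h : α ∈ interval N)
    (d : ClassicalDims) {n : ℕ} (hn : n < 6) {a : ℚ} (ha : 0 < a) (hne : ∀ j ≤ N, a ≠ expo α j) :
    (PowerSeries.coeff n (logBlock α d.1.1 d.1.2)).coeff (-a) = 0 := by
  obtain ⟨G, r, hG⟩ := exists_expansion d hn
  rw [(hG α (one_lt_of_mem_interval hN h)).coeff_of_forall_ne ha.le, if_neg ha.ne']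
  rintro j rfl
  exact hne j ((expo_pos_iff hN h).mp ha) rfl

theorem coeff_cpow (a b : ℚ) (x : ℝ) : (cpow a x).coeff (-b) = if b = a then x else 0 := by
  rw [cpow, HahnSeries.coeff_single]
  simp only [neg_inj]

theorem prin_coeff_logBlock {N : ℕ} (hN : 1 ≤ N) {α : ℚ} (h : α ∈ interval N)
    (d : ClassicalDims) {n : ℕ} (hn : n < 6) :
    prin (PowerSeries.coeff n (logBlock α d.1.1 d.1.2)) =
      (∑ j ∈ Finset.range (N + 1), cpow (expo α j) ((coeffFun α (expo α j) d).coeff n))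
        + cpow 0 ((coeffFun α 0 d).coeff n) := by
  have hα := one_lt_of_mem_interval hN h
  ext i
  obtain ⟨a, rfl⟩ : ∃ a, i = -a := ⟨-i, (neg_neg i).symm⟩
  simp only [coeff_coeffFun _ _ _ hn, HahnSeries.coeff_add, HahnSeries.coeff_sum, coeff_cpow]
  change (if -a ≤ 0 then _ else _) = _
  by_cases hex : ∃ j ≤ N, a = expo α j
  · obtain ⟨j, hj, rfl⟩ := hex
    have hpos := (expo_pos_iff hN h).mpr hj
    rw [if_pos (by linarith), if_neg hpos.ne', add_zero,
      Finset.sum_eq_single_of_mem j (Finset.mem_range.mpr (by omega)), if_pos rfl]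
    intro i _ hij
    exact if_neg fun e => hij (expo_injective hα e).symm
  · push Not at hex
    rw [Finset.sum_eq_zero fun j hj =>
      if_neg (hex j (Nat.lt_succ_iff.mp (Finset.mem_range.mp hj))), zero_add]
    rcases lt_trichotomy a 0 with ha | rfl | ha
    · rw [if_neg (by linarith), if_neg ha.ne]
    · simp
    · rw [if_pos (by linarith), if_neg ha.ne', coeff_eq_zero_of_forall_ne hN h d hn ha hex]

theorem coeffFun_ne_zero {α a : ℚ} (d : ClassicalDims) {n : ℕ} (hn : n < 6)
    (h : (PowerSeries.coeff n (logBlock α d.1.1 d.1.2)).coeff (-a) ≠ 0) : coeffFun α a ≠ 0 := by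
  intro h0
  rw [← coeff_coeffFun _ _ _ hn, h0] at h
  exact h (Polynomial.coeff_zero n)

theorem coeffFun_expo_ne_zero {α : ℚ} (hα : 1 < α) {j : ℕ} (hj : 0 < expo α j) :
    coeffFun α (expo α j) ≠ 0 := by
  obtain ⟨G, r, hG, hG0, hexp⟩ := expansion_dimsOne
  refine coeffFun_ne_zero dimsOne (n := 2) (by norm_num) ?_
  rw [(hexp α hα).coeff_expo hj.le, if_neg hj.ne', add_zero]
  rcases Nat.eq_zero_or_pos j with rfl | hj
  · rw [hG0]; norm_num
  · rw [hG j hj]; positivity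

/-- At `dimsSpecial` the series $G$ has no terms with $j\ge1$, so nothing can cancel $r=\frac1{32}$,
even at an exceptional point. -/
theorem coeffFun_zero_ne_zero {α : ℚ} (hα : 1 < α) : coeffFun α 0 ≠ 0 := by
  refine coeffFun_ne_zero dimsSpecial (n := 2) (by norm_num) ?_
  have hexp := expansion_dimsSpecial α hα
  by_cases h : ∃ j, 0 = expo α j
  · obtain ⟨j, hj⟩ := h
    have hj0 : j ≠ 0 := by
      rintro rfl
      rw [expo_eq] at hj
      simp at hj
      linarith
    rw [hj, hexp.coeff_expo hj.le, if_pos hj.symm, PowerSeries.coeff_C, if_neg hj0]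
    norm_num
  · push Not at h
    rw [hexp.coeff_of_forall_ne le_rfl h, if_pos rfl]
    norm_num

theorem prinExponents_eq {N : ℕ} (hN : 1 ≤ N) {α : ℚ} (h : α ∈ interval N) :
    prinExponents α = insert 0 {a | ∃ j ≤ N, a = expo α j} := by
  have hα := one_lt_of_mem_interval hN h
  ext a
  simp only [prinExponents, Set.mem_ofPred_eq, Set.mem_insert_iff]
  constructor
  · rintro ⟨ha, hne⟩
    by_contra hcon
    push Not at hcon
    have hpos := lt_of_le_of_ne ha hcon.1.symm
    apply hne
    ext d n
    by_cases hn : n < 6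
    · rw [coeff_coeffFun _ _ _ hn, coeff_eq_zero_of_forall_ne hN h d hn hpos hcon.2]
      simp
    · rw [coeffFun, PowerSeries.coeff_trunc, if_neg hn]
      simp
  · rintro (rfl | ⟨j, hj, rfl⟩)
    · exact ⟨le_rfl, coeffFun_zero_ne_zero hα⟩
    · have hpos := (expo_pos_iff hN h).mpr hj
      exact ⟨hpos.le, coeffFun_expo_ne_zero hα hpos⟩

theorem ncard_prinExponents {N : ℕ} (hN : 1 ≤ N) {α : ℚ} (h : α ∈ interval N) :
    (prinExponents α).ncard = N + 2 := by
  have hα := one_lt_of_mem_interval hN h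
  have himage : {a | ∃ j ≤ N, a = expo α j} =
      ((Finset.range (N + 1)).image (expo α) : Finset ℚ) := by
    ext a
    simp [eq_comm]
  have h0 : (0 : ℚ) ∉ (Finset.range (N + 1)).image (expo α) := by
    intro hmem
    obtain ⟨j, hj, hj0⟩ := Finset.mem_image.mp hmem
    exact ((expo_pos_iff hN h).mpr (Nat.lt_succ_iff.mp (Finset.mem_range.mp hj))).ne' hj0
  rw [prinExponents_eq hN h, himage, ← Finset.coe_insert, Set.ncard_coe_finset,
    Finset.card_insert_of_notMem h0, Finset.card_image_of_injective _ (expo_injective hα),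
    Finset.card_range]

theorem coeffFun_expo_eq {α α' : ℚ} (hα : 1 < α) (hα' : 1 < α') {j : ℕ} (hj : 0 < expo α j)
    (hj' : 0 < expo α' j) : coeffFun α (expo α j) = coeffFun α' (expo α' j) := by
  refine coeffFun_ext fun d n hn => ?_
  obtain ⟨G, r, hG⟩ := exists_expansion d hn
  rw [(hG α hα).coeff_expo hj.le, (hG α' hα').coeff_expo hj'.le, if_neg hj.ne', if_neg hj'.ne']

theorem RegularPoint.coeffFun_zero_eq {α α' : ℚ} (h : RegularPoint α) (h' : RegularPoint α') :
    coeffFun α 0 = coeffFun α' 0 := by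
  refine coeffFun_ext fun d n hn => ?_
  obtain ⟨G, r, hG⟩ := exists_expansion d hn
  rw [(hG α h.1).coeff_of_forall_ne le_rfl fun j => (h.expo_ne_zero j).symm,
    (hG α' h'.1).coeff_of_forall_ne le_rfl fun j => (h'.expo_ne_zero j).symm]

/-- At `δ = δt = 1` the constant term of the level-two coefficient is `r` at regular points and is
shifted by `25 / 64 * (-1 / 8) ^ (N + 1)` at the `N`-th exceptional point. -/
theorem exists_coeffFun_zero_dimsOne : ∃ r : ℝ,
    (∀ α, RegularPoint α → (coeffFun α 0 dimsOne).coeff 2 = r) ∧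
    ∀ N : ℕ, 1 ≤ N →
      (coeffFun (exceptional N) 0 dimsOne).coeff 2 = 25 / 64 * (-1 / 8) ^ (N + 1) + r := by
  obtain ⟨G, r, hG, -, hexp⟩ := expansion_dimsOne
  refine ⟨r, fun α h => ?_, fun N hN => ?_⟩
  · rw [coeff_coeffFun _ _ _ (by norm_num),
      (hexp α h.1).coeff_of_forall_ne le_rfl fun j => (h.expo_ne_zero j).symm, if_pos rfl]
  · have h0 := expo_exceptional hN
    have := (hexp _ (one_lt_exceptional hN)).coeff_expo h0.ge
    rw [h0, if_pos rfl, hG _ (by omega)] at this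
    rw [coeff_coeffFun _ _ _ (by norm_num), this]

theorem coeffFun_exceptional_ne_regular {N : ℕ} (hN : 1 ≤ N) {α : ℚ} (h : RegularPoint α) :
    coeffFun (exceptional N) 0 ≠ coeffFun α 0 := by
  intro heq
  obtain ⟨r, hreg, hexc⟩ := exists_coeffFun_zero_dimsOne
  have h1 := hexc N hN
  rw [heq, hreg α h] at h1
  have : (25 / 64 * (-1 / 8) ^ (N + 1) : ℝ) ≠ 0 := by positivity
  exact this (by linarith)

theorem coeffFun_exceptional_ne {N N' : ℕ} (hN : 1 ≤ N) (hN' : 1 ≤ N') (hne : N ≠ N') :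
    coeffFun (exceptional N) 0 ≠ coeffFun (exceptional N') 0 := by
  intro heq
  obtain ⟨r, -, hexc⟩ := exists_coeffFun_zero_dimsOne
  have h1 := hexc N hN
  rw [heq, hexc N' hN'] at h1
  have h2 : ((-1 / 8 : ℝ)) ^ (N' + 1) = (-1 / 8) ^ (N + 1) := by linarith
  -- The base is negative, so injectivity of the power is applied to absolute values.
  have h3 := congrArg abs h2
  rw [abs_pow, abs_pow] at h3
  have h4 : |(-1 / 8 : ℝ)| = 1 / 8 := by norm_num [abs_of_neg]
  rw [h4] at h3
  have h5 := pow_right_injective₀ (by norm_num : (0 : ℝ) < 1 / 8) (by norm_num) h3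
  omega

end VirBlock

theorem proposition2 :
    -- the block is well defined up to order `z ^ 5`
    (∀ α : ℚ, 1 < α → ∀ d : ClassicalDims, ∀ n < 6,
      (gram (cpow 1 1) (cpow α d.1.2) n).det ≠ 0) ∧
    -- the principal part
    (∀ N : ℕ, 1 ≤ N → ∀ α ∈ interval N,
      (∀ d : ClassicalDims, ∀ n < 6,
        prin (PowerSeries.coeff n (logBlock α d.1.1 d.1.2)) =
          (∑ j ∈ Finset.range (N + 1), cpow (expo α j) ((coeffFun α (expo α j) d).coeff n))
            + cpow 0 ((coeffFun α 0 d).coeff n)) ∧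
      prinExponents α = insert 0 {a | ∃ j ≤ N, a = expo α j} ∧
      (prinExponents α).ncard = N + 2) ∧
    -- the columns of positive powers agree
    (∀ N N' : ℕ, 1 ≤ N → 1 ≤ N' → ∀ α ∈ interval N, ∀ α' ∈ interval N',
      ∀ j : ℕ, j ≤ N → j ≤ N' → coeffFun α (expo α j) = coeffFun α' (expo α' j)) ∧
    -- the constant term is the same at all regular points
    (∀ α α' : ℚ, RegularPoint α → RegularPoint α' → coeffFun α 0 = coeffFun α' 0) ∧
    -- it changes at the exceptional points, where its values are pairwise different
    (∀ N : ℕ, 1 ≤ N → ∀ α : ℚ, RegularPoint α →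
      coeffFun (exceptional N) 0 ≠ coeffFun α 0) ∧
    (∀ N N' : ℕ, 1 ≤ N → 1 ≤ N' → N ≠ N' →
      coeffFun (exceptional N) 0 ≠ coeffFun (exceptional N') 0) ∧
    -- three terms for `α ≥ 2`
    (∀ α : ℚ, 2 ≤ α → (prinExponents α).ncard = 3) := by

  refine ⟨fun α hα d n _ => det_gram_ne_zero hα d.2 n, fun N hN α h =>
    ⟨fun d n hn => prin_coeff_logBlock hN h d hn, prinExponents_eq hN h, ncard_prinExponents hN h⟩,
    fun N N' hN hN' α h α' h' j hj hj' =>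
      coeffFun_expo_eq (one_lt_of_mem_interval hN h) (one_lt_of_mem_interval hN' h')
        ((expo_pos_iff hN h).mpr hj) ((expo_pos_iff hN' h').mpr hj'),
    fun α α' h h' => h.coeffFun_zero_eq h',
    fun N hN α h => coeffFun_exceptional_ne_regular hN h,
    fun N N' hN hN' hne => coeffFun_exceptional_ne hN hN' hne,
    -- This is the case $N=1$, whose interval is $[2,\infty)$.
    fun α hα => ncard_prinExponents le_rfl ⟨?_, Or.inl rfl⟩⟩
  norm_num
  exact hα
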